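/- Let $V$ be a simple vertex operator algebra over $\mathbb{C}$, let $g$ be an automorphism of $V$ of finite order $K$, and write $V^r=\{v\in V: gv=e^{2\pi i r/K}v\}$ for $r\in\mathbb{Z}/K\mathbb{Z}$, so that $V^0$ is the vertex operator algebra of $g$-fixed points. *Notation.* A $g$-twisted $V$-module $M$ is $\mathbb{C}$-graded by $L(0)$-eigenspaces $M_\lambda$ with $\dim M_\lambda<\infty$ and $M_{\lambda+n}=0$ for every $\lambda\in\mathbb C$ and all sufficiently negative integers $n$, has vertex operators $Y_M(v,z)=\sum_{n\in r/K+\mathbb{Z}}v_nz^{-n-1}$ for $v\in V^r$, and satisfies the usual truncation, vacuum, Virasoro and $L(-1)$-derivative axioms and the twisted Jacobi identity. Let $\bar V=\bigoplus_{r=0}^{K-1}V^r\otimes t^{r/K}\mathbb{C}[t,t^{-1}]$, and let $U_g(V)$ be the quotient of the tensor algebra $T(\bar V)$ by the ideal of elements acting as $0$ (with $v\otimes t^n$ acting as $v_n$) on every $g$-twisted $V$-module; it is graded by $\mathrm{wt}(v\otimes t^n)=\mathrm{wt}\,v-n-1$. Let $C$ be the algebra of those $\sum_{i\ge 0} a_iX^i\in\bigoplus_{\nu\in\frac1K\mathbb{Z}}U_g(V)_\nu[[X]]$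 such that, for every $g$-twisted module $M$ and every $m\in M$, $a_im=0$ for all but finitely many $i$. It acts on $M$ by $m\mapsto\sum_i a_im$. Let $A(g)$ be the quotient of $C$ by the ideal of elements that act as $0$ on every $g$-twisted module. The inclusion $V^0\subseteq V$ induces an algebra homomorphism $\bar\psi:A(V^0)\to A(g)$, where $A(V^0)$ is the same algebra formed for $V^0$ and its identity automorphism. For an untwisted $V^0$-module $N$ let $$\mathrm{Ind}\,N=\{f\in\mathrm{Hom}_{A(V^0)}(A(g),N) : Jf=0 \text{ for some } J=\mathrm{Ann}_{A(g)}(m),\ m \text{ in a } g\text{-twisted } V\text{-module}\},$$ an $A(g)$-module under $(af)(x)=f(xa)$. The socle of a module is its largest semisimple submodule. *Statement.* Let $M$ be a simple $g$-twisted $V$-module, let $\mu$ be a weight of $M$ (that is, $M_\mu\neq0$), and for $r\in\mathbb{Z}$ put $M^r=\bigoplus_{n\in\mathbb{Z}}M_{\mu-r/K+n}$, a $V^0$-submodule of $M$ which is the $e^{2\pi i r/K}$-eigenspace of the action of $g$ on $M$ by the scalar $e^{2\pi i(\mu-\nu)}$ on $M_\nu$. Then for every $r$: 1. $\mathrm{Ind}\,M^r\neq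 0$; 2. $\mathrm{Ind}\,M^r$ has exactly one simple $A(g)$-submodule, and this submodule is isomorphic to $M$; 3. $M$ occurs exactly once in the socle of $\mathrm{Ind}\,M^r$: the socle is a direct sum of simple submodules, and in every such decomposition exactly one summand is isomorphic to $M$. -/

import Mathlib

universe u

noncomputable section

/-! ### Vertex operator algebras -/

/-- A vertex operator algebra `(V, Y, 𝟏, ω)` over `ℂ`, with `Y(v, z) = ∑ vₙ z^(-n-1)` given by its
modes `vₙ = mode n v`.  With `L(n) = ω_(n+1)`, the weight space `V_n` is the `n`-eigenspace of
`L(0)`, so the `ℤ`-grading of `V` is recorded by the fields `grading`, `finite_weight` and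
`bounded_below`.  (That `𝟏` has weight `0` and `ω` has weight `2` follows from `creation` and
`virasoro`.) The field `jacobi` is the Jacobi identity, coefficient by coefficient; its sums are
finite by `truncation`. -/
structure VertexOperatorAlgebra (V : Type u) [AddCommGroup V] [Module ℂ V] where
  mode : ℤ → V →ₗ[ℂ] Module.End ℂ V
  vac : V
  conf : V
  rank : ℂ
  truncation : ∀ u v : V, ∃ N : ℤ, ∀ n : ℤ, N ≤ n → mode n u v = 0
  vacuum : ∀ (n : ℤ) (v : V), mode n vac v = if n = -1 then v else 0
  creation : ∀ v : V, mode (-1) v vac = v ∧ ∀ n : ℤ, 0 ≤ n → mode n v vac = 0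
  jacobi : ∀ (u v w : V) (p s t : ℤ),
    ∑ᶠ m : ℕ, ((-1 : ℂ) ^ m * ((Ring.choose p m : ℤ) : ℂ)) •
        (mode (p + s - m) u (mode (t + m) v w)
          - (-1 : ℂ) ^ p • mode (p + t - m) v (mode (s + m) u w))
      = ∑ᶠ m : ℕ, ((Ring.choose s m : ℤ) : ℂ) • mode (s + t - m) (mode (p + m) u v) w
  virasoro : ∀ (m n : ℤ) (w : V),
    mode (m + 1) conf (mode (n + 1) conf w) - mode (n + 1) conf (mode (m + 1) conf w)
      = ((m : ℂ) - n) • mode (m + n + 1) conf w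
        + (if m + n = 0 then (((m : ℂ) ^ 3 - m) / 12) * rank else 0) • w
  derivative : ∀ (n : ℤ) (v w : V), mode n (mode 0 conf v) w = (-(n : ℂ)) • mode (n - 1) v w
  grading : ⨆ n : ℤ, (mode 1 conf).eigenspace (n : ℂ) = ⊤
  finite_weight : ∀ n : ℤ, Module.Finite ℂ ((mode 1 conf).eigenspace (n : ℂ))
  bounded_below : ∃ N : ℤ, ∀ n : ℤ, n ≤ N → (mode 1 conf).eigenspace (n : ℂ) = ⊥

namespace VertexOperatorAlgebra

section Basic

variable {V : Type u} [AddCommGroup V] [Module ℂ V] (𝒱 : VertexOperatorAlgebra V)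

/-- `V` is simple: it is nonzero and has no proper nonzero ideal (`V`-submodule of `V`). -/
def IsSimple : Prop :=
  Nontrivial V ∧ ∀ I : Submodule ℂ V,
    (∀ (n : ℤ) (u : V), ∀ v ∈ I, 𝒱.mode n u v ∈ I) → I = ⊥ ∨ I = ⊤

/-- The weight space `V_n`. -/
def weightSpace (n : ℤ) : Submodule ℂ V := (𝒱.mode 1 𝒱.conf).eigenspace (n : ℂ)

/-- An automorphism of the vertex operator algebra. -/
structure Automorphism where
  toEquiv : V ≃ₗ[ℂ] V
  map_mode : ∀ (n : ℤ) (u v : V), toEquiv (𝒱.mode n u v) = 𝒱.mode n (toEquiv u) (toEquiv v)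
  map_vac : toEquiv 𝒱.vac = 𝒱.vac
  map_conf : toEquiv 𝒱.conf = 𝒱.conf

/-- The identity automorphism. -/
def Automorphism.refl : 𝒱.Automorphism where
  toEquiv := LinearEquiv.refl ℂ V
  map_mode _ _ _ := rfl
  map_vac := rfl
  map_conf := rfl

end Basic

section Twisted

variable {V : Type u} [AddCommGroup V] [Module ℂ V] {𝒱 : VertexOperatorAlgebra V}

/-- The eigenspace `{v | g v = e^(2πis) v}` for `s ∈ ℚ`.  If `g` has order `K`, this is `V^r` for
`s ∈ r/K + ℤ`, and it is zero for `s ∉ (1/K)ℤ`. -/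
def Automorphism.sector (g : 𝒱.Automorphism) (s : ℚ) : Submodule ℂ V :=
  Module.End.eigenspace (g.toEquiv : V →ₗ[ℂ] V) (Complex.exp (2 * Real.pi * Complex.I * (s : ℂ)))

/-- The structure of a `g`-twisted `V`-module on the vector space `M`, with
`Y_M(v, z) = ∑ vₙ z^(-n-1)`, `n ∈ ℚ`, given by its modes `vₙ = mode n v`.  As `L(0) = ω_1` acts on
`M_μ` as the scalar `μ`, the weight space `M_μ` is the `μ`-eigenspace of `L(0)`, and the
`ℂ`-grading is recorded by the fields `grading`, `finite_weight` and `bounded_below`.  The field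
`jacobi` is the twisted Jacobi identity, coefficient by coefficient: for `u ∈ V^r` the coefficients
involved have `s ∈ r/K + ℤ`.  Its sums are finite by `truncation`. -/
structure TwistedModule (g : 𝒱.Automorphism) (M : Type u) [AddCommGroup M] [Module ℂ M] where
  mode : ℚ → V →ₗ[ℂ] Module.End ℂ M
  mode_support : ∀ (s n : ℚ) (v : V), v ∈ g.sector s → (¬ ∃ k : ℤ, n = s + k) → mode n v = 0
  truncation : ∀ (v : V) (w : M), ∃ N : ℚ, ∀ n : ℚ, N ≤ n → mode n v w = 0
  vacuum : ∀ (n : ℚ) (w : M), mode n 𝒱.vac w = if n = -1 then w else 0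
  jacobi : ∀ (s : ℚ) (u : V), u ∈ g.sector s → ∀ (v : V) (w : M) (p : ℤ) (t : ℚ),
    ∑ᶠ m : ℕ, ((-1 : ℂ) ^ m * ((Ring.choose p m : ℤ) : ℂ)) •
        (mode (p + s - m) u (mode (t + m) v w)
          - (-1 : ℂ) ^ p • mode (p + t - m) v (mode (s + m) u w))
      = ∑ᶠ m : ℕ, ((Ring.choose s m : ℚ) : ℂ) • mode (s + t - m) (𝒱.mode (p + m) u v) w
  virasoro : ∀ (m n : ℤ) (w : M),
    mode (m + 1) 𝒱.conf (mode (n + 1) 𝒱.conf w) - mode (n + 1) 𝒱.conf (mode (m + 1) 𝒱.conf w)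
      = ((m : ℂ) - n) • mode (m + n + 1) 𝒱.conf w
        + (if m + n = 0 then (((m : ℂ) ^ 3 - m) / 12) * 𝒱.rank else 0) • w
  derivative : ∀ (n : ℚ) (v : V) (w : M),
    mode n (𝒱.mode 0 𝒱.conf v) w = (-(n : ℂ)) • mode (n - 1) v w
  grading : ⨆ μ : ℂ, (mode 1 𝒱.conf).eigenspace μ = ⊤
  finite_weight : ∀ μ : ℂ, Module.Finite ℂ ((mode 1 𝒱.conf).eigenspace μ)
  bounded_below : ∀ μ : ℂ, ∃ N : ℤ, ∀ n : ℤ, n ≤ N → (mode 1 𝒱.conf).eigenspace (μ + n) = ⊥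

namespace TwistedModule

variable {g : 𝒱.Automorphism} {M : Type u} [AddCommGroup M] [Module ℂ M]

/-- The weight space `M_μ`. -/
def weightSpace (Y : TwistedModule g M) (μ : ℂ) : Submodule ℂ M :=
  (Y.mode 1 𝒱.conf).eigenspace μ

/-- `M` is a simple `g`-twisted `V`-module. -/
def IsSimple (Y : TwistedModule g M) : Prop :=
  Nontrivial M ∧ ∀ N : Submodule ℂ M,
    (∀ (n : ℚ) (v : V), ∀ x ∈ N, Y.mode n v x ∈ N) → N = ⊥ ∨ N = ⊤

end TwistedModule

end Twisted

/-! ### Subspaces stable under a diagonalizable operator -/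

section Diagonalizable

variable {W : Type*} [AddCommGroup W] [Module ℂ W]

theorem components_mem (f : Module.End ℂ W) (p : Submodule ℂ W) (hp : ∀ x ∈ p, f x ∈ p)
    {ι : Type*} (c : ι → ℂ) (hc : Function.Injective c) (s : Finset ι) :
    ∀ y : ι → W, (∀ i ∈ s, f (y i) = c i • y i) → ∑ i ∈ s, y i ∈ p → ∀ i ∈ s, y i ∈ p := by
  classical
  induction s using Finset.induction_on with
  | empty => intro y _ _ i hi; simp at hi
  | insert a s ha ih =>
    intro y hy hsum
    have h1 : ∑ i ∈ s, (c i - c a) • y i ∈ p := by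
      have h2 : f (∑ i ∈ insert a s, y i) - c a • ∑ i ∈ insert a s, y i ∈ p :=
        p.sub_mem (hp _ hsum) (p.smul_mem _ hsum)
      rw [map_sum, Finset.smul_sum, ← Finset.sum_sub_distrib, Finset.sum_insert ha] at h2
      rw [hy a (Finset.mem_insert_self _ _), sub_self, zero_add] at h2
      convert h2 using 1
      refine Finset.sum_congr rfl fun i hi => ?_
      rw [hy i (Finset.mem_insert_of_mem hi), sub_smul]
    have h3 := ih (fun i => (c i - c a) • y i) (fun i hi => by
      rw [map_smul, hy i (Finset.mem_insert_of_mem hi), smul_comm]) h1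
    have h4 : ∀ i ∈ s, y i ∈ p := fun i hi => by
      have hne : c i - c a ≠ 0 := sub_ne_zero.mpr fun h => ha (hc h ▸ hi)
      exact (p.smul_mem_iff hne).mp (h3 i hi)
    intro i hi
    rcases Finset.mem_insert.mp hi with rfl | hi
    · rw [Finset.sum_insert ha] at hsum
      exact (p.add_mem_iff_left (p.sum_mem h4)).mp hsum
    · exact h4 i hi

theorem iSup_eigenspace_restrict (f : Module.End ℂ W) (p : Submodule ℂ W) (f' : Module.End ℂ p)
    (hf : ∀ x : p, ((f' x : p) : W) = f x) {ι : Type*} (c : ι → ℂ) (hc : Function.Injective c)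
    (h : ⨆ i, f.eigenspace (c i) = ⊤) : ⨆ i, f'.eigenspace (c i) = ⊤ := by
  classical
  rw [eq_top_iff]
  rintro ⟨x, hx⟩ -
  have hx' : x ∈ ⨆ i, f.eigenspace (c i) := h ▸ Submodule.mem_top
  obtain ⟨y, hy, hsum⟩ := (Submodule.mem_iSup_iff_exists_finsupp _ _).mp hx'
  have hmem := components_mem f p (fun x hx => by simpa [hf] using (f' ⟨x, hx⟩).2) c hc y.support y
    (fun i _ => Module.End.mem_eigenspace_iff.mp (hy i)) (by
      have : ∑ i ∈ y.support, y i = x := hsum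
      rw [this]; exact hx)
  have hmem' : ∀ i, y i ∈ p := fun i => by
    by_cases hi : i ∈ y.support
    · exact hmem i hi
    · rw [Finsupp.notMem_support_iff.mp hi]; exact p.zero_mem
  have : (⟨x, hx⟩ : p) = ∑ i ∈ y.support, ⟨y i, hmem' i⟩ := by
    apply Subtype.ext
    rw [AddSubmonoidClass.coe_finsetSum]
    exact hsum.symm
  rw [this]
  refine Submodule.sum_mem _ fun i _ => Submodule.mem_iSup_of_mem i ?_
  rw [Module.End.mem_eigenspace_iff]
  apply Subtype.ext
  rw [hf]
  exact Module.End.mem_eigenspace_iff.mp (hy i)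

theorem finite_eigenspace_of_injective {W' : Type*} [AddCommGroup W'] [Module ℂ W']
    (f : Module.End ℂ W) (f' : Module.End ℂ W') (j : W' →ₗ[ℂ] W) (hj : Function.Injective j)
    (hf : ∀ x, j (f' x) = f (j x)) (μ : ℂ) (h : Module.Finite ℂ (f.eigenspace μ)) :
    Module.Finite ℂ (f'.eigenspace μ) := by
  have hmem : ∀ x ∈ f'.eigenspace μ, j x ∈ f.eigenspace μ := fun x hx => by
    rw [Module.End.mem_eigenspace_iff] at hx ⊢
    rw [← hf, hx, map_smul]
  refine Module.Finite.of_injective (j.restrict hmem) fun x y hxy => ?_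
  exact Subtype.ext (hj (congrArg Subtype.val hxy))

theorem eigenspace_eq_bot_of_injective {W' : Type*} [AddCommGroup W'] [Module ℂ W']
    (f : Module.End ℂ W) (f' : Module.End ℂ W') (j : W' →ₗ[ℂ] W) (hj : Function.Injective j)
    (hf : ∀ x, j (f' x) = f (j x)) (μ : ℂ) (h : f.eigenspace μ = ⊥) :
    f'.eigenspace μ = ⊥ := by
  rw [eq_bot_iff]
  intro x hx
  have : j x ∈ f.eigenspace μ := by
    rw [Module.End.mem_eigenspace_iff] at hx ⊢
    rw [← hf, hx, map_smul]
  rw [h, Submodule.mem_bot] at this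
  exact hj (this.trans (map_zero j).symm)

theorem coe_finsum (p : Submodule ℂ W) (f : ℕ → p) :
    ((∑ᶠ m, f m : p) : W) = ∑ᶠ m, (f m : W) :=
  p.subtype.toAddMonoidHom.map_finsum_of_injective Subtype.val_injective f

end Diagonalizable

/-! ### The fixed-point subalgebra `V⁰` and restriction to it -/

section Fixed

variable {V : Type u} [AddCommGroup V] [Module ℂ V] {𝒱 : VertexOperatorAlgebra V}

/-- The subspace `V⁰` of fixed points of `g`. -/
def Automorphism.fixedSpace (g : 𝒱.Automorphism) : Submodule ℂ V where
  carrier := {v | g.toEquiv v = v}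
  add_mem' {a b} ha hb := by
    simp only [Set.mem_ofPred_eq] at *
    rw [map_add, ha, hb]
  zero_mem' := map_zero _
  smul_mem' c a ha := by
    simp only [Set.mem_ofPred_eq] at *
    rw [map_smul, ha]

theorem Automorphism.mem_fixedSpace {g : 𝒱.Automorphism} {v : V} :
    v ∈ g.fixedSpace ↔ g.toEquiv v = v := Iff.rfl

theorem Automorphism.mode_mem_fixedSpace (g : 𝒱.Automorphism) (n : ℤ) {u v : V}
    (hu : u ∈ g.fixedSpace) (hv : v ∈ g.fixedSpace) : 𝒱.mode n u v ∈ g.fixedSpace := by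
  rw [mem_fixedSpace] at *
  rw [g.map_mode, hu, hv]

/-- The fixed points `V⁰` as a vertex operator algebra, with the same `𝟏` and `ω`. -/
def Automorphism.fixed (g : 𝒱.Automorphism) : VertexOperatorAlgebra g.fixedSpace where
  mode n := LinearMap.mk₂ ℂ (fun u v => ⟨𝒱.mode n u v, g.mode_mem_fixedSpace n u.2 v.2⟩)
    (fun _ _ _ => Subtype.ext (by simp)) (fun _ _ _ => Subtype.ext (by simp))
    (fun _ _ _ => Subtype.ext (by simp)) (fun _ _ _ => Subtype.ext (by simp))
  vac := ⟨𝒱.vac, g.map_vac⟩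
  conf := ⟨𝒱.conf, g.map_conf⟩
  rank := 𝒱.rank
  truncation u v := by
    obtain ⟨N, hN⟩ := 𝒱.truncation u v
    exact ⟨N, fun n hn => Subtype.ext (hN n hn)⟩
  vacuum n v := by
    apply Subtype.ext
    have := 𝒱.vacuum n v
    split_ifs at this ⊢ <;> exact this
  creation v := ⟨Subtype.ext (𝒱.creation v).1, fun n hn => Subtype.ext ((𝒱.creation v).2 n hn)⟩
  jacobi u v w p s t := by
    apply Subtype.ext
    have h := 𝒱.jacobi u v w p s t
    rw [coe_finsum, coe_finsum]
    exact h
  virasoro m n w := by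
    apply Subtype.ext
    exact 𝒱.virasoro m n w
  derivative n v w := Subtype.ext (𝒱.derivative n v w)
  grading := iSup_eigenspace_restrict (𝒱.mode 1 𝒱.conf) g.fixedSpace _ (fun _ => rfl)
    (fun n : ℤ => (n : ℂ)) Int.cast_injective 𝒱.grading
  finite_weight n := finite_eigenspace_of_injective _ _ g.fixedSpace.subtype
    Subtype.val_injective (fun _ => rfl) _ (𝒱.finite_weight n)
  bounded_below := by
    obtain ⟨N, hN⟩ := 𝒱.bounded_below
    exact ⟨N, fun n hn => eigenspace_eq_bot_of_injective _ _ g.fixedSpace.subtype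
      Subtype.val_injective (fun _ => rfl) _ (hN n hn)⟩

theorem Automorphism.coe_mem_sector (g : 𝒱.Automorphism) {s : ℚ} {v : g.fixedSpace}
    (hv : v ∈ (Automorphism.refl g.fixed).sector s) : (v : V) ∈ g.sector s := by
  unfold sector at *
  rw [Module.End.mem_eigenspace_iff] at *
  exact (show g.toEquiv (v : V) = v from v.2).trans (congrArg Subtype.val hv)

namespace TwistedModule

variable {g : 𝒱.Automorphism} {M : Type u} [AddCommGroup M] [Module ℂ M]

/-- A `g`-twisted `V`-module is an untwisted `V⁰`-module by restriction. -/
def restrict (Y : TwistedModule g M) : TwistedModule (Automorphism.refl g.fixed) M where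
  mode n := Y.mode n ∘ₗ g.fixedSpace.subtype
  mode_support s n v hv h := Y.mode_support s n v (g.coe_mem_sector hv) h
  truncation v w := Y.truncation v w
  vacuum n w := Y.vacuum n w
  jacobi s u hu v w p t := Y.jacobi s u (g.coe_mem_sector hu) v w p t
  virasoro m n w := Y.virasoro m n w
  derivative n v w := Y.derivative n v w
  grading := Y.grading
  finite_weight := Y.finite_weight
  bounded_below := Y.bounded_below

/-- A subspace stable under all modes is a twisted module. -/
def sub (Y : TwistedModule g M) (N : Submodule ℂ M)
    (hN : ∀ (n : ℚ) (v : V), ∀ x ∈ N, Y.mode n v x ∈ N) : TwistedModule g N where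
  mode n := LinearMap.mk₂ ℂ (fun v x => ⟨Y.mode n v x, hN n v x x.2⟩)
    (fun _ _ _ => Subtype.ext (by simp)) (fun _ _ _ => Subtype.ext (by simp))
    (fun _ _ _ => Subtype.ext (by simp)) (fun _ _ _ => Subtype.ext (by simp))
  mode_support s n v hv h := by
    ext x
    exact congrArg (fun f : Module.End ℂ M => f x) (Y.mode_support s n v hv h)
  truncation v w := by
    obtain ⟨R, hR⟩ := Y.truncation v w
    exact ⟨R, fun n hn => Subtype.ext (hR n hn)⟩
  vacuum n w := by
    apply Subtype.ext
    have := Y.vacuum n w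
    split_ifs at this ⊢ <;> exact this
  jacobi s u hu v w p t := by
    apply Subtype.ext
    have h := Y.jacobi s u hu v w p t
    rw [coe_finsum, coe_finsum]
    exact h
  virasoro m n w := by
    apply Subtype.ext
    exact Y.virasoro m n w
  derivative n v w := Subtype.ext (Y.derivative n v w)
  grading := iSup_eigenspace_restrict (Y.mode 1 𝒱.conf) N _ (fun _ => rfl)
    (fun μ : ℂ => μ) Function.injective_id Y.grading
  finite_weight μ := finite_eigenspace_of_injective _ _ N.subtype
    Subtype.val_injective (fun _ => rfl) _ (Y.finite_weight μ)
  bounded_below μ := by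
    obtain ⟨R, hR⟩ := Y.bounded_below μ
    exact ⟨R, fun n hn => eigenspace_eq_bot_of_injective _ _ N.subtype
      Subtype.val_injective (fun _ => rfl) _ (hR n hn)⟩

end TwistedModule

end Fixed

/-! ### Direct sums of twisted modules and the zero module -/

section DirectSum

variable {V : Type u} [AddCommGroup V] [Module ℂ V] {𝒱 : VertexOperatorAlgebra V}

namespace TwistedModule

variable {g : 𝒱.Automorphism} {M : Type u} [AddCommGroup M] [Module ℂ M]
  {N : Type u} [AddCommGroup N] [Module ℂ N]

theorem finite_support_of_eventually {M : Type*} [AddCommGroup M] {f : ℕ → M} (R : ℕ) (h : ∀ m, R ≤ m → f m = 0) :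
    (Function.support f).Finite :=
  (Set.finite_lt_nat R).subset fun m hm => by
    by_contra hlt
    exact hm (h m (not_lt.mp hlt))

theorem finite_support_left (mode : ℚ → V →ₗ[ℂ] Module.End ℂ M)
    (htr : ∀ (v : V) (w : M), ∃ R : ℚ, ∀ n : ℚ, R ≤ n → mode n v w = 0)
    (u v : V) (w : M) (p : ℤ) (s t : ℚ) :
    (Function.support fun m : ℕ => ((-1 : ℂ) ^ m * ((Ring.choose p m : ℤ) : ℂ)) •
        (mode (p + s - m) u (mode (t + m) v w)
          - (-1 : ℂ) ^ p • mode (p + t - m) v (mode (s + m) u w))).Finite := by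
  obtain ⟨R₁, h₁⟩ := htr v w
  obtain ⟨R₂, h₂⟩ := htr u w
  obtain ⟨R, hR⟩ := exists_nat_ge (max (R₁ - t) (R₂ - s))
  refine finite_support_of_eventually R fun m hm => ?_
  have hm' : (R : ℚ) ≤ m := by exact_mod_cast hm
  have e₁ := h₁ (t + m) (by linarith [le_max_left (R₁ - t) (R₂ - s)])
  have e₂ := h₂ (s + m) (by linarith [le_max_right (R₁ - t) (R₂ - s)])
  simp [e₁, e₂]

theorem finite_support_right (mode : ℚ → V →ₗ[ℂ] Module.End ℂ M)
    (u v : V) (w : M) (p : ℤ) (s t : ℚ) :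
    (Function.support fun m : ℕ =>
      ((Ring.choose s m : ℚ) : ℂ) • mode (s + t - m) (𝒱.mode (p + m) u v) w).Finite := by
  obtain ⟨R₁, h₁⟩ := 𝒱.truncation u v
  refine finite_support_of_eventually (R₁ - p).toNat fun m hm => ?_
  have e₁ := h₁ (p + m) (by omega)
  simp [e₁]

/-- The direct sum of two `g`-twisted modules. -/
def prod (Y : TwistedModule g M) (Z : TwistedModule g N) : TwistedModule g (M × N) :=
  let md : ℚ → V →ₗ[ℂ] Module.End ℂ (M × N) := fun n =>
    { toFun := fun v => LinearMap.prodMap (Y.mode n v) (Z.mode n v)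
      map_add' := fun a b => by ext <;> simp
      map_smul' := fun c a => by ext <;> simp }
  have htr : ∀ (v : V) (w : M × N), ∃ R : ℚ, ∀ n : ℚ, R ≤ n → md n v w = 0 := fun v w => by
    obtain ⟨R₁, h₁⟩ := Y.truncation v w.1
    obtain ⟨R₂, h₂⟩ := Z.truncation v w.2
    exact ⟨max R₁ R₂, fun n hn => Prod.ext (h₁ n ((le_max_left _ _).trans hn))
      (h₂ n ((le_max_right _ _).trans hn))⟩
  { mode := md
    mode_support := fun s n v hv h => by
      ext x <;> simp [md, Y.mode_support s n v hv h, Z.mode_support s n v hv h]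
    truncation := htr
    vacuum := fun n w => by
      refine Prod.ext ((Y.vacuum n w.1).trans ?_) ((Z.vacuum n w.2).trans ?_) <;> split_ifs <;> rfl
    jacobi := fun s u hu v w p t => by
      have hl := finite_support_left md htr u v w p s t
      have hr := finite_support_right (𝒱 := 𝒱) md u v w p s t
      refine Prod.ext ?_ ?_
      · exact ((LinearMap.fst ℂ M N).toAddMonoidHom.map_finsum hl).trans
          ((Y.jacobi s u hu v w.1 p t).trans
            ((LinearMap.fst ℂ M N).toAddMonoidHom.map_finsum hr).symm)
      · exact ((LinearMap.snd ℂ M N).toAddMonoidHom.map_finsum hl).trans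
          ((Z.jacobi s u hu v w.2 p t).trans
            ((LinearMap.snd ℂ M N).toAddMonoidHom.map_finsum hr).symm)
    virasoro := fun m n w => Prod.ext (Y.virasoro m n w.1) (Z.virasoro m n w.2)
    derivative := fun n v w => Prod.ext (Y.derivative n v w.1) (Z.derivative n v w.2)
    grading := by
      rw [eq_top_iff]
      rintro ⟨x, y⟩ -
      have hx : (x, (0 : N)) ∈ ⨆ μ : ℂ, (md 1 𝒱.conf).eigenspace μ := by
        have : x ∈ ⨆ μ : ℂ, (Y.mode 1 𝒱.conf).eigenspace μ := Y.grading ▸ Submodule.mem_top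
        have h := Submodule.mem_map_of_mem (f := LinearMap.inl ℂ M N) this
        rw [Submodule.map_iSup] at h
        refine SetLike.le_def.mp (iSup_mono fun μ => ?_) h
        rintro _ ⟨z, hz, rfl⟩
        rw [SetLike.mem_coe, Module.End.mem_eigenspace_iff] at hz
        rw [Module.End.mem_eigenspace_iff]
        exact Prod.ext hz (by simp [md])
      have hy : ((0 : M), y) ∈ ⨆ μ : ℂ, (md 1 𝒱.conf).eigenspace μ := by
        have : y ∈ ⨆ μ : ℂ, (Z.mode 1 𝒱.conf).eigenspace μ := Z.grading ▸ Submodule.mem_top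
        have h := Submodule.mem_map_of_mem (f := LinearMap.inr ℂ M N) this
        rw [Submodule.map_iSup] at h
        refine SetLike.le_def.mp (iSup_mono fun μ => ?_) h
        rintro _ ⟨z, hz, rfl⟩
        rw [SetLike.mem_coe, Module.End.mem_eigenspace_iff] at hz
        rw [Module.End.mem_eigenspace_iff]
        exact Prod.ext (by simp [md]) hz
      have := Submodule.add_mem _ hx hy
      rwa [Prod.mk_add_mk, add_zero, zero_add] at this
    finite_weight := fun μ => by
      have h₁ := Y.finite_weight μ
      have h₂ := Z.finite_weight μ
      have h : ∀ x ∈ (md 1 𝒱.conf).eigenspace μ,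
          x.1 ∈ (Y.mode 1 𝒱.conf).eigenspace μ ∧ x.2 ∈ (Z.mode 1 𝒱.conf).eigenspace μ := by
        intro x hx
        simp only [Module.End.mem_eigenspace_iff] at hx ⊢
        exact ⟨congrArg Prod.fst hx, congrArg Prod.snd hx⟩
      refine Module.Finite.of_injective
        (((LinearMap.fst ℂ M N).restrict (fun x hx => (h x hx).1)).prod
          ((LinearMap.snd ℂ M N).restrict (fun x hx => (h x hx).2))) fun x y hxy => ?_
      have e₁ := congrArg (fun z => (z.1 : M)) hxy
      have e₂ := congrArg (fun z => (z.2 : N)) hxy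
      exact Subtype.ext (Prod.ext e₁ e₂)
    bounded_below := fun μ => by
      obtain ⟨R₁, h₁⟩ := Y.bounded_below μ
      obtain ⟨R₂, h₂⟩ := Z.bounded_below μ
      refine ⟨min R₁ R₂, fun n hn => ?_⟩
      rw [eq_bot_iff]
      intro x hx
      rw [Module.End.mem_eigenspace_iff] at hx
      have e₁ : x.1 ∈ (Y.mode 1 𝒱.conf).eigenspace (μ + n) :=
        Module.End.mem_eigenspace_iff.mpr (congrArg Prod.fst hx)
      have e₂ : x.2 ∈ (Z.mode 1 𝒱.conf).eigenspace (μ + n) :=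
        Module.End.mem_eigenspace_iff.mpr (congrArg Prod.snd hx)
      rw [h₁ n (hn.trans (min_le_left _ _)), Submodule.mem_bot] at e₁
      rw [h₂ n (hn.trans (min_le_right _ _)), Submodule.mem_bot] at e₂
      exact Prod.ext e₁ e₂ }

/-- The zero module. -/
def zero (g : 𝒱.Automorphism) : TwistedModule g PUnit.{u + 1} where
  mode _ := 0
  mode_support _ _ _ _ _ := rfl
  truncation _ _ := ⟨0, fun _ _ => rfl⟩
  vacuum _ _ := Subsingleton.elim _ _
  jacobi _ _ _ _ _ _ _ := Subsingleton.elim _ _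
  virasoro _ _ _ := Subsingleton.elim _ _
  derivative _ _ _ := Subsingleton.elim _ _
  grading := Subsingleton.elim _ _
  finite_weight _ := inferInstance
  bounded_below _ := ⟨0, fun _ _ => Subsingleton.elim _ _⟩

end TwistedModule

end DirectSum

/-! ### The `V⁰`-components `M^r` of a twisted module -/

section Components

variable {V : Type u} [AddCommGroup V] [Module ℂ V] {𝒱 : VertexOperatorAlgebra V}

theorem Automorphism.conf_mem_sector (g : 𝒱.Automorphism) : 𝒱.conf ∈ g.sector 1 := by
  unfold sector
  rw [Module.End.mem_eigenspace_iff]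
  simpa using g.map_conf

theorem Automorphism.fixed_mem_sector (g : 𝒱.Automorphism) (v : g.fixedSpace) :
    (v : V) ∈ g.sector 0 := by
  unfold sector
  rw [Module.End.mem_eigenspace_iff]
  simpa using mem_fixedSpace.mp v.2

namespace TwistedModule

variable {g : 𝒱.Automorphism} {M : Type u} [AddCommGroup M] [Module ℂ M]

theorem mode_mem_weightSpace (Y : TwistedModule g M) {d : ℤ} {v : V} (hv : v ∈ 𝒱.weightSpace d)
    (n : ℚ) {μ : ℂ} {x : M} (hx : x ∈ Y.weightSpace μ) :
    Y.mode n v x ∈ Y.weightSpace (μ + d - n - 1) := by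
  have h := Y.jacobi 1 𝒱.conf g.conf_mem_sector v x 0 n
  have hl : ∀ m : ℕ, m ≠ 0 → Ring.choose (0 : ℤ) m = 0 := fun m hm => by
    rw [Ring.choose_zero_ite, if_neg hm]
  rw [finsum_eq_single _ 0 (fun m hm => by rw [hl m hm]; simp)] at h
  rw [finsum_eq_sum_of_support_subset (s := {0, 1})] at h
  · unfold weightSpace VertexOperatorAlgebra.weightSpace at *
    rw [Module.End.mem_eigenspace_iff] at *
    rw [Finset.sum_pair (by norm_num)] at h
    simp only [pow_zero, Ring.choose_zero_right, Int.cast_one, mul_one, Int.cast_zero, zero_add,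
      Nat.cast_zero, sub_zero, add_zero, zpow_zero, one_smul, hx, hv, Ring.choose_one_right,
      map_smul, LinearMap.smul_apply, Nat.cast_one, Rat.cast_one, Y.derivative] at h
    rw [sub_eq_iff_eq_add] at h
    rw [h]
    have e₁ : (1 : ℚ) + n - 1 = n := by ring
    rw [e₁, ← add_smul, ← add_smul]
    congr 1
    push_cast
    ring
  · intro m hm
    by_contra hne
    simp only [Finset.coe_insert, Finset.coe_singleton, Set.mem_insert_iff, Set.mem_singleton_iff,
      not_or] at hne
    refine hm ?_
    have : Ring.choose (1 : ℚ) m = 0 := by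
      have := Ring.choose_natCast (R := ℚ) 1 m
      rw [Nat.cast_one, Nat.choose_eq_zero_of_lt (by omega), Nat.cast_zero] at this
      exact this
    simp [this]

/-- For a weight `μ` of `M`, the space `M^r = ⨁_{n ∈ ℤ} M_(μ - r/K + n)`, where `K` is the order of
`g`.  When the weights of `M` lie in `μ + (1/K)ℤ`, as they do for simple `M`, this is the
`e^(2πir/K)`-eigenspace of the action of `g` on `M` by the scalar `e^(2πi(μ - ν))` on `M_ν`. -/
def component (Y : TwistedModule g M) (μ : ℂ) (r : ℤ) : Submodule ℂ M :=
  ⨆ n : ℤ, Y.weightSpace (μ - (r : ℂ) / (orderOf g.toEquiv : ℂ) + n)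

theorem mode_mem_component (Y : TwistedModule g M) (μ : ℂ) (r : ℤ) (n : ℚ) (v : g.fixedSpace)
    (x : M) (hx : x ∈ Y.component μ r) : Y.restrict.mode n v x ∈ Y.component μ r := by
  change Y.mode n (v : V) x ∈ Y.component μ r
  by_cases hn : ∃ k : ℤ, n = (0 : ℚ) + k
  · obtain ⟨k, rfl⟩ := hn
    have hv : (v : V) ∈ ⨆ d : ℤ, 𝒱.weightSpace d := by
      have := 𝒱.grading
      change ⨆ d : ℤ, 𝒱.weightSpace d = ⊤ at this
      rw [this]
      exact Submodule.mem_top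
    generalize (v : V) = v' at hv
    induction hv using Submodule.iSup_induction' with
    | zero => simp
    | add a b _ _ ha hb =>
      rw [map_add, LinearMap.add_apply]
      exact Submodule.add_mem _ ha hb
    | mem d a ha =>
      unfold component at hx
      induction hx using Submodule.iSup_induction' with
      | zero => simp
      | add y z _ _ hy hz =>
        rw [map_add]
        exact Submodule.add_mem _ hy hz
      | mem l y hy =>
        refine Submodule.mem_iSup_of_mem (l + d - k - 1) ?_
        convert Y.mode_mem_weightSpace ha (0 + k) hy using 2
        push_cast
        ring
  · rw [Y.mode_support 0 n v (g.fixed_mem_sector v) hn]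
    exact Submodule.zero_mem _

/-- `M^r` as an untwisted `V⁰`-module. -/
def componentModule (Y : TwistedModule g M) (μ : ℂ) (r : ℤ) :
    TwistedModule (Automorphism.refl g.fixed) (Y.component μ r) :=
  Y.restrict.sub (Y.component μ r) (Y.mode_mem_component μ r)

end TwistedModule

end Components

/-! ### The enveloping algebra `U_g(V)` -/

section Enveloping

variable {V : Type u} [AddCommGroup V] [Module ℂ V] {𝒱 : VertexOperatorAlgebra V}

/-- `V̄ = ⨁_r V^r ⊗ t^(r/K) ℂ[t, t⁻¹]`, realized as the space of finitely supported functions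
`f : ℚ → V` with `f q ∈ V^r` for `q ∈ r/K + ℤ`; here `v ⊗ t^q` is `Finsupp.single q v`. -/
def Automorphism.loopSpace (g : 𝒱.Automorphism) : Submodule ℂ (ℚ →₀ V) where
  carrier := {f | ∀ q, f q ∈ g.sector q}
  add_mem' ha hb q := Submodule.add_mem _ (ha q) (hb q)
  zero_mem' _ := Submodule.zero_mem _
  smul_mem' c _ ha q := Submodule.smul_mem _ c (ha q)

/-- The element `v ⊗ t^q` of `V̄`. -/
def Automorphism.tens (g : 𝒱.Automorphism) (q : ℚ) (v : V) (hv : v ∈ g.sector q) : g.loopSpace :=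
  ⟨Finsupp.single q v, fun q' => by
    by_cases h : q = q'
    · subst h; simpa using hv
    · rw [Finsupp.single_eq_of_ne (Ne.symm h)]; exact Submodule.zero_mem _⟩

namespace TwistedModule

variable {g : 𝒱.Automorphism} {M : Type u} [AddCommGroup M] [Module ℂ M]

/-- The linear map `V̄ → End M`, `v ⊗ t^q ↦ v_q`. -/
def loopAction (Y : TwistedModule g M) : g.loopSpace →ₗ[ℂ] Module.End ℂ M :=
  (Finsupp.lsum ℂ fun q => Y.mode q) ∘ₗ g.loopSpace.subtype

/-- The induced algebra homomorphism `T(V̄) → End M`. -/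
def tensorAction (Y : TwistedModule g M) : TensorAlgebra ℂ g.loopSpace →ₐ[ℂ] Module.End ℂ M :=
  TensorAlgebra.lift ℂ Y.loopAction

end TwistedModule

/-- The ideal `I` of `T(V̄)`, the intersection of the kernels of the actions on all `g`-twisted
modules. -/
def Automorphism.kernel (g : 𝒱.Automorphism) : Ideal (TensorAlgebra ℂ g.loopSpace) where
  carrier := {x | ∀ (M : Type u) [AddCommGroup M] [Module ℂ M] (Y : TwistedModule g M),
    Y.tensorAction x = 0}
  add_mem' ha hb M _ _ Y := by rw [map_add, ha M Y, hb M Y, add_zero]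
  zero_mem' M _ _ Y := map_zero _
  smul_mem' c x hx M _ _ Y := by rw [smul_eq_mul, map_mul, hx M Y, mul_zero]

instance (g : 𝒱.Automorphism) : g.kernel.IsTwoSided where
  mul_mem_of_left b ha M _ _ Y := by rw [map_mul, ha M Y, zero_mul]

/-- The `g`-twisted enveloping algebra `U_g(V) = T(V̄)/I`. -/
def Automorphism.U (g : 𝒱.Automorphism) : Type u := TensorAlgebra ℂ g.loopSpace ⧸ g.kernel

instance (g : 𝒱.Automorphism) : Ring g.U :=
  inferInstanceAs (Ring (TensorAlgebra ℂ g.loopSpace ⧸ g.kernel))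

instance (g : 𝒱.Automorphism) : Algebra ℂ g.U :=
  inferInstanceAs (Algebra ℂ (TensorAlgebra ℂ g.loopSpace ⧸ g.kernel))

/-- The quotient map `T(V̄) → U_g(V)`. -/
def Automorphism.toU (g : 𝒱.Automorphism) : TensorAlgebra ℂ g.loopSpace →ₐ[ℂ] g.U :=
  Ideal.Quotient.mkₐ ℂ g.kernel

/-- The action of `U_g(V)` on a `g`-twisted module. -/
def TwistedModule.actionU {g : 𝒱.Automorphism} {M : Type u} [AddCommGroup M] [Module ℂ M]
    (Y : TwistedModule g M) : g.U →ₐ[ℂ] Module.End ℂ M :=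
  Ideal.Quotient.liftₐ g.kernel Y.tensorAction fun _ hx => hx M Y

theorem TwistedModule.actionU_toU {g : 𝒱.Automorphism} {M : Type u} [AddCommGroup M] [Module ℂ M]
    (Y : TwistedModule g M) (x : TensorAlgebra ℂ g.loopSpace) :
    Y.actionU (g.toU x) = Y.tensorAction x := rfl

/-- `IsMonomial g μ x`: `x = (v¹ ⊗ t^(q₁)) ⋯ (vᵏ ⊗ t^(qₖ))` with homogeneous `vⁱ` and
`∑ (wt vⁱ - qᵢ - 1) = μ`. -/
inductive Automorphism.IsMonomial (g : 𝒱.Automorphism) : ℚ → TensorAlgebra ℂ g.loopSpace → Prop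
  | one : IsMonomial g 0 1
  | mul (d : ℤ) (q : ℚ) (v : V) (hv : v ∈ g.sector q) (hd : v ∈ 𝒱.weightSpace d) (μ : ℚ)
      (x : TensorAlgebra ℂ g.loopSpace) (hx : IsMonomial g μ x) :
      IsMonomial g ((d : ℚ) - q - 1 + μ) (TensorAlgebra.ι ℂ (g.tens q v hv) * x)

theorem Automorphism.IsMonomial.mul' {g : 𝒱.Automorphism} {μ ν : ℚ}
    {x y : TensorAlgebra ℂ g.loopSpace} (hx : g.IsMonomial μ x) (hy : g.IsMonomial ν y) :
    g.IsMonomial (μ + ν) (x * y) := by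
  induction hx with
  | one => simpa using hy
  | mul d q v hv hd μ x _ ih =>
    rw [mul_assoc, add_assoc]
    exact .mul d q v hv hd _ _ ih

/-- The homogeneous subspace `U_g(V)_μ`. -/
def Automorphism.gradedU (g : 𝒱.Automorphism) (μ : ℚ) : Submodule ℂ g.U :=
  Submodule.span ℂ (g.toU '' {x | g.IsMonomial μ x})

theorem Automorphism.mul_mem_gradedU {g : 𝒱.Automorphism} {μ ν : ℚ} {a b : g.U}
    (ha : a ∈ g.gradedU μ) (hb : b ∈ g.gradedU ν) : a * b ∈ g.gradedU (μ + ν) := by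
  induction ha using Submodule.span_induction with
  | zero => rw [zero_mul]; exact Submodule.zero_mem _
  | add x y _ _ hx hy => rw [add_mul]; exact Submodule.add_mem _ hx hy
  | smul c x _ hx => rw [smul_mul_assoc]; exact Submodule.smul_mem _ c hx
  | mem x hx =>
    obtain ⟨x, hx, rfl⟩ := hx
    induction hb using Submodule.span_induction with
    | zero => rw [mul_zero]; exact Submodule.zero_mem _
    | add y z _ _ hy hz => rw [mul_add]; exact Submodule.add_mem _ hy hz
    | smul c y _ hy => rw [mul_smul_comm]; exact Submodule.smul_mem _ c hy
    | mem y hy =>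
      obtain ⟨y, hy, rfl⟩ := hy
      rw [← map_mul]
      exact Submodule.subset_span ⟨_, hx.mul' hy, rfl⟩

theorem Automorphism.one_mem_gradedU (g : 𝒱.Automorphism) : (1 : g.U) ∈ g.gradedU 0 :=
  Submodule.subset_span ⟨1, .one, map_one _⟩

end Enveloping

/-! ### The algebra `A(g)` -/

section AlgebraA

variable {V : Type u} [AddCommGroup V] [Module ℂ V] {𝒱 : VertexOperatorAlgebra V}

/-- `U_g(V)_μ[[X]]`. -/
def Automorphism.gradedSeries (g : 𝒱.Automorphism) (μ : ℚ) : Submodule ℂ (PowerSeries g.U) where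
  carrier := {f | ∀ i, PowerSeries.coeff i f ∈ g.gradedU μ}
  add_mem' ha hb i := by rw [map_add]; exact Submodule.add_mem _ (ha i) (hb i)
  zero_mem' i := by rw [map_zero]; exact Submodule.zero_mem _
  smul_mem' c f hf i := Submodule.smul_mem _ c (hf i)

/-- The algebra `⨁_μ U_g(V)_μ[[X]]` inside `U_g(V)[[X]]`. -/
def Automorphism.series (g : 𝒱.Automorphism) : Subalgebra ℂ (PowerSeries g.U) :=
  Submodule.toSubalgebra (⨆ μ : ℚ, g.gradedSeries μ)
    (Submodule.mem_iSup_of_mem 0 fun i => by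
      rw [PowerSeries.coeff_one]
      split_ifs
      · exact g.one_mem_gradedU
      · exact Submodule.zero_mem _)
    (fun a b ha hb => by
      induction ha using Submodule.iSup_induction' with
      | zero => rw [zero_mul]; exact Submodule.zero_mem _
      | add x y _ _ hx hy => rw [add_mul]; exact Submodule.add_mem _ hx hy
      | mem μ x hx =>
        induction hb using Submodule.iSup_induction' with
        | zero => rw [mul_zero]; exact Submodule.zero_mem _
        | add y z _ _ hy hz => rw [mul_add]; exact Submodule.add_mem _ hy hz
        | mem ν y hy =>
          refine Submodule.mem_iSup_of_mem (μ + ν) fun i => ?_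
          rw [PowerSeries.coeff_mul]
          exact Submodule.sum_mem _ fun p _ => mul_mem_gradedU (hx p.1) (hy p.2))

namespace TwistedModule

variable {g : 𝒱.Automorphism} {M : Type u} [AddCommGroup M] [Module ℂ M]

/-- `f = ∑ aᵢ Xⁱ` lies in the preimage of `C_M`: for each `m ∈ M`, `∑ (aᵢ m) Xⁱ` is a polynomial. -/
def Summable (Y : TwistedModule g M) (f : PowerSeries g.U) : Prop :=
  ∀ m : M, (Function.support fun i => Y.actionU (PowerSeries.coeff i f) m).Finite

/-- The value `∑ aᵢ m` of `f = ∑ aᵢ Xⁱ` at `m`. -/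
def value (Y : TwistedModule g M) (f : PowerSeries g.U) (m : M) : M :=
  ∑ᶠ i : ℕ, Y.actionU (PowerSeries.coeff i f) m

variable (Y : TwistedModule g M)

theorem summable_C (a : g.U) (m : M) : ∀ i, i ≠ 0 →
    Y.actionU (PowerSeries.coeff i (PowerSeries.C a)) m = 0 := fun i hi => by
  rw [PowerSeries.coeff_C, if_neg hi, map_zero, LinearMap.zero_apply]

theorem Summable.C (a : g.U) : Y.Summable (PowerSeries.C a) := fun m =>
  (Set.finite_singleton 0).subset fun i hi => by
    by_contra h
    exact hi (Y.summable_C a m i h)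

theorem value_C (a : g.U) (m : M) : Y.value (PowerSeries.C a) m = Y.actionU a m := by
  unfold value
  rw [finsum_eq_single _ 0 (Y.summable_C a m), PowerSeries.coeff_zero_C]

variable {Y}

theorem Summable.add {f h : PowerSeries g.U} (hf : Y.Summable f) (hh : Y.Summable h) :
    Y.Summable (f + h) := fun m => by
  refine ((hf m).union (hh m)).subset ?_
  intro i hi
  by_contra hn
  simp only [Set.mem_union, Function.mem_support, not_or, not_not] at hn
  exact hi (by simp [hn.1, hn.2])

theorem value_add {f h : PowerSeries g.U} (hf : Y.Summable f) (hh : Y.Summable h) (m : M) :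
    Y.value (f + h) m = Y.value f m + Y.value h m := by
  unfold value
  rw [← finsum_add_distrib (hf m) (hh m)]
  simp

theorem value_map_add {f : PowerSeries g.U} (hf : Y.Summable f) (m m' : M) :
    Y.value f (m + m') = Y.value f m + Y.value f m' := by
  unfold value
  rw [← finsum_add_distrib (hf m) (hf m')]
  simp

theorem value_map_smul (f : PowerSeries g.U) (c : ℂ) (m : M) :
    Y.value f (c • m) = c • Y.value f m := by
  unfold value
  simp only [map_smul]
  rw [← smul_finsum]

theorem value_eq_sum {f : PowerSeries g.U} {m : M} (s : Finset ℕ)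
    (h : ∀ i, i ∉ s → Y.actionU (PowerSeries.coeff i f) m = 0) :
    Y.value f m = ∑ i ∈ s, Y.actionU (PowerSeries.coeff i f) m :=
  finsum_eq_sum_of_support_subset _ fun i hi => by
    by_contra hn
    exact hi (h i hn)

theorem mul_bounds {f h : PowerSeries g.U} (hf : Y.Summable f) (hh : Y.Summable h) (m : M) :
    ∃ R : ℕ, ∀ i j : ℕ, R ≤ i ∨ R ≤ j →
      Y.actionU (PowerSeries.coeff i f) (Y.actionU (PowerSeries.coeff j h) m) = 0 ∧
      (R ≤ j → Y.actionU (PowerSeries.coeff j h) m = 0) ∧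
      (R ≤ i → Y.actionU (PowerSeries.coeff i f) (Y.value h m) = 0) := by
  have key : ∀ (f : PowerSeries g.U), Y.Summable f → ∀ m, ∃ R : ℕ, ∀ i, R ≤ i →
      Y.actionU (PowerSeries.coeff i f) m = 0 := fun f hf m => by
    obtain ⟨R, hR⟩ := (hf m).bddAbove
    refine ⟨R + 1, fun i hi => ?_⟩
    by_contra hn
    have := hR hn
    omega
  obtain ⟨R₀, h₀⟩ := key h hh m
  obtain ⟨R₁, h₁⟩ := key f hf (Y.value h m)
  choose S hS using fun j => key f hf (Y.actionU (PowerSeries.coeff j h) m)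
  have hle : ∀ j ∈ Finset.range R₀, S j ≤ (Finset.range R₀).sup S := fun j hj =>
    Finset.le_sup (f := S) hj
  refine ⟨max (max R₀ R₁) ((Finset.range R₀).sup S), fun i j hij => ⟨?_, fun hj => ?_, fun hi => ?_⟩⟩
  · by_cases hj : R₀ ≤ j
    · rw [h₀ j hj, map_zero]
    · have := hle j (Finset.mem_range.mpr (by omega))
      exact hS j i (by omega)
  · exact h₀ j (by omega)
  · exact h₁ i (by omega)

theorem coeff_mul_apply (f h : PowerSeries g.U) (i : ℕ) (m : M) :
    Y.actionU (PowerSeries.coeff i (f * h)) m = ∑ p ∈ Finset.HasAntidiagonal.antidiagonal i,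
      Y.actionU (PowerSeries.coeff p.1 f) (Y.actionU (PowerSeries.coeff p.2 h) m) := by
  rw [PowerSeries.coeff_mul, map_sum, LinearMap.sum_apply]
  simp [Module.End.mul_apply]

theorem Summable.mul {f h : PowerSeries g.U} (hf : Y.Summable f) (hh : Y.Summable h) :
    Y.Summable (f * h) := fun m => by
  obtain ⟨R, hR⟩ := mul_bounds hf hh m
  refine finite_support_of_eventually (2 * R) fun i hi => ?_
  rw [coeff_mul_apply]
  refine Finset.sum_eq_zero fun p hp => (hR _ _ ?_).1
  rw [Finset.HasAntidiagonal.mem_antidiagonal] at hp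
  omega

theorem value_mul {f h : PowerSeries g.U} (hf : Y.Summable f) (hh : Y.Summable h) (m : M) :
    Y.value (f * h) m = Y.value f (Y.value h m) := by
  obtain ⟨R, hR⟩ := mul_bounds hf hh m
  rw [value_eq_sum (f := f * h) (Finset.range (2 * R)), value_eq_sum (f := f) (Finset.range R)]
  · rw [value_eq_sum (f := h) (Finset.range R)]
    · simp only [map_sum, coeff_mul_apply]
      rw [← Finset.sum_product' (Finset.range R) (Finset.range R) fun i j =>
        Y.actionU (PowerSeries.coeff i f) (Y.actionU (PowerSeries.coeff j h) m)]
      rw [Finset.sum_sigma']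
      symm
      refine Finset.sum_of_injOn (fun p => ⟨p.1 + p.2, p⟩) ?_ ?_ ?_ ?_
      · rintro ⟨a, b⟩ _ ⟨c, d⟩ _ hab
        simp only [Sigma.mk.injEq] at hab
        exact eq_of_heq hab.2
      · rintro ⟨a, b⟩ hab
        simp only [Finset.coe_product, Finset.coe_range, Set.mem_prod, Set.mem_Iio] at hab
        simp only [Finset.coe_sigma, Finset.coe_range, Set.mem_sigma_iff, Set.mem_Iio,
          Finset.mem_coe, Finset.HasAntidiagonal.mem_antidiagonal, and_true]
        omega
      · rintro ⟨i, a, b⟩ hi hn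
        simp only [Finset.mem_sigma, Finset.mem_range, Finset.HasAntidiagonal.mem_antidiagonal] at hi
        obtain ⟨hi, rfl⟩ := hi
        refine (hR a b ?_).1
        by_contra hlt
        push Not at hlt
        exact hn ⟨(a, b), by simpa using hlt, rfl⟩
      · intro _ _
        rfl
    · intro i hi
      rw [Finset.mem_range, not_lt] at hi
      exact (hR i i (Or.inl hi)).2.1 hi
  · intro i hi
    rw [Finset.mem_range, not_lt] at hi
    exact (hR i i (Or.inl hi)).2.2 hi
  · intro i hi
    rw [Finset.mem_range, not_lt] at hi
    rw [coeff_mul_apply]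
    refine Finset.sum_eq_zero fun p hp => (hR _ _ ?_).1
    rw [Finset.HasAntidiagonal.mem_antidiagonal] at hp
    omega

end TwistedModule

/-- The algebra `C`: the series in `⨁_μ U_g(V)_μ[[X]]` that lie in `C_M` for every `g`-twisted
module `M`. -/
def Automorphism.algC (g : 𝒱.Automorphism) : Subalgebra ℂ (PowerSeries g.U) where
  carrier := {f | f ∈ g.series ∧
    ∀ (M : Type u) [AddCommGroup M] [Module ℂ M] (Y : TwistedModule g M), Y.Summable f}
  mul_mem' ha hb := ⟨g.series.mul_mem ha.1 hb.1, fun M _ _ Y => (ha.2 M Y).mul (hb.2 M Y)⟩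
  add_mem' ha hb := ⟨g.series.add_mem ha.1 hb.1, fun M _ _ Y => (ha.2 M Y).add (hb.2 M Y)⟩
  algebraMap_mem' c := ⟨g.series.algebraMap_mem c, fun M _ _ Y => by
    rw [PowerSeries.algebraMap_apply]
    exact TwistedModule.Summable.C Y _⟩

/-- The action of `C` on a `g`-twisted module, `f ↦ (m ↦ ∑ aᵢ m)`. -/
def TwistedModule.actionC {g : 𝒱.Automorphism} {M : Type u} [AddCommGroup M] [Module ℂ M]
    (Y : TwistedModule g M) : g.algC →ₐ[ℂ] Module.End ℂ M where
  toFun f :=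
    { toFun := Y.value f
      map_add' := value_map_add (f.2.2 M Y)
      map_smul' := value_map_smul (Y := Y) f }
  map_one' := by
    ext m
    have := Y.value_C 1 m
    rw [map_one, map_one] at this
    exact this
  map_mul' a b := by
    ext m
    exact value_mul (a.2.2 M Y) (b.2.2 M Y) m
  map_zero' := by
    ext m
    have := Y.value_C 0 m
    rw [map_zero, map_zero] at this
    exact this
  map_add' a b := by
    ext m
    exact value_add (a.2.2 M Y) (b.2.2 M Y) m
  commutes' c := by
    ext m
    have := Y.value_C (algebraMap ℂ g.U c) m
    rw [AlgHom.commutes] at this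
    refine Eq.trans ?_ this
    change Y.value (algebraMap ℂ (PowerSeries g.U) c) m = _
    rw [PowerSeries.algebraMap_apply]

/-- The intersection of the annihilators in `C` of all `g`-twisted modules. -/
def Automorphism.annC (g : 𝒱.Automorphism) : Ideal g.algC where
  carrier := {x | ∀ (M : Type u) [AddCommGroup M] [Module ℂ M] (Y : TwistedModule g M),
    Y.actionC x = 0}
  add_mem' ha hb M _ _ Y := by rw [map_add, ha M Y, hb M Y, add_zero]
  zero_mem' M _ _ Y := map_zero _
  smul_mem' c x hx M _ _ Y := by rw [smul_eq_mul, map_mul, hx M Y, mul_zero]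

instance (g : 𝒱.Automorphism) : g.annC.IsTwoSided where
  mul_mem_of_left b ha M _ _ Y := by rw [map_mul, ha M Y, zero_mul]

/-- The algebra `A(g) = C / ⋂_M Ann_C(M)`. -/
def Automorphism.A (g : 𝒱.Automorphism) : Type u := g.algC ⧸ g.annC

instance (g : 𝒱.Automorphism) : Ring g.A := inferInstanceAs (Ring (g.algC ⧸ g.annC))

instance (g : 𝒱.Automorphism) : Algebra ℂ g.A := inferInstanceAs (Algebra ℂ (g.algC ⧸ g.annC))

/-- The quotient map `C → A(g)`. -/
def Automorphism.toA (g : 𝒱.Automorphism) : g.algC →ₐ[ℂ] g.A := Ideal.Quotient.mkₐ ℂ g.annC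

/-- The action of `A(g)` on a `g`-twisted module. -/
def TwistedModule.action {g : 𝒱.Automorphism} {M : Type u} [AddCommGroup M] [Module ℂ M]
    (Y : TwistedModule g M) : g.A →ₐ[ℂ] Module.End ℂ M :=
  Ideal.Quotient.liftₐ g.annC Y.actionC fun _ hx => hx M Y

end AlgebraA

/-! ### The homomorphism `A(V⁰) → A(g)` -/

section Psi

variable {V : Type u} [AddCommGroup V] [Module ℂ V] {𝒱 : VertexOperatorAlgebra V}
  (g : 𝒱.Automorphism)

/-- `V⁰` with the identity automorphism. -/
abbrev Automorphism.onFixed : g.fixed.Automorphism := Automorphism.refl g.fixed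

/-- The embedding of `V̄⁰ = V⁰ ⊗ ℂ[t, t⁻¹]` in `V̄`. -/
def Automorphism.loopIncl : g.onFixed.loopSpace →ₗ[ℂ] g.loopSpace :=
  (Finsupp.mapRange.linearMap g.fixedSpace.subtype).restrict
    fun f hf q => g.coe_mem_sector (v := f q) (hf q)

/-- The induced homomorphism `T(V̄⁰) → T(V̄)`. -/
def Automorphism.tensorIncl :
    TensorAlgebra ℂ g.onFixed.loopSpace →ₐ[ℂ] TensorAlgebra ℂ g.loopSpace :=
  TensorAlgebra.lift ℂ (TensorAlgebra.ι ℂ ∘ₗ g.loopIncl)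

theorem Automorphism.tensorIncl_ι (x : g.onFixed.loopSpace) :
    g.tensorIncl (TensorAlgebra.ι ℂ x) = TensorAlgebra.ι ℂ (g.loopIncl x) := by
  unfold tensorIncl
  rw [TensorAlgebra.lift_ι_apply]
  rfl

variable {g}

theorem TwistedModule.loopAction_restrict {M : Type u} [AddCommGroup M] [Module ℂ M]
    (Y : TwistedModule g M) (x : g.onFixed.loopSpace) :
    Y.restrict.loopAction x = Y.loopAction (g.loopIncl x) := by
  change Finsupp.sum _ _ = Finsupp.sum (Finsupp.mapRange _ (map_zero g.fixedSpace.subtype) _) _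
  rw [Finsupp.sum_mapRange_index]
  · rfl
  · intro q
    simp

theorem TwistedModule.tensorAction_restrict {M : Type u} [AddCommGroup M] [Module ℂ M]
    (Y : TwistedModule g M) (x : TensorAlgebra ℂ g.onFixed.loopSpace) :
    Y.restrict.tensorAction x = Y.tensorAction (g.tensorIncl x) := by
  have : Y.restrict.tensorAction = Y.tensorAction.comp g.tensorIncl := by
    refine TensorAlgebra.hom_ext (LinearMap.ext fun x => ?_)
    simp only [LinearMap.comp_apply, AlgHom.toLinearMap_apply, AlgHom.comp_apply,
      g.tensorIncl_ι, TwistedModule.tensorAction, TensorAlgebra.lift_ι_apply]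
    exact Y.loopAction_restrict x
  rw [this]
  rfl

variable (g)

/-- The induced homomorphism `U(V⁰) → U_g(V)`. -/
def Automorphism.inclU : g.onFixed.U →ₐ[ℂ] g.U :=
  Ideal.Quotient.liftₐ g.onFixed.kernel (g.toU.comp g.tensorIncl) fun x hx => by
    refine Ideal.Quotient.eq_zero_iff_mem.mpr ?_
    intro M _ _ Y
    exact (Y.tensorAction_restrict x).symm.trans (hx M Y.restrict)

theorem Automorphism.inclU_toU (x : TensorAlgebra ℂ g.onFixed.loopSpace) :
    g.inclU (g.onFixed.toU x) = g.toU (g.tensorIncl x) := rfl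

variable {g}

theorem TwistedModule.actionU_restrict {M : Type u} [AddCommGroup M] [Module ℂ M]
    (Y : TwistedModule g M) (x : g.onFixed.U) :
    Y.restrict.actionU x = Y.actionU (g.inclU x) := by
  obtain ⟨x, rfl⟩ := Ideal.Quotient.mk_surjective x
  exact Y.tensorAction_restrict x

theorem Automorphism.IsMonomial.incl {μ : ℚ} {x : TensorAlgebra ℂ g.onFixed.loopSpace}
    (hx : g.onFixed.IsMonomial μ x) : g.IsMonomial μ (g.tensorIncl x) := by
  induction hx with
  | one => rw [map_one]; exact .one
  | mul d q v hv hd μ x _ ih =>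
    rw [map_mul, g.tensorIncl_ι]
    have e : g.loopIncl (g.onFixed.tens q v hv) = g.tens q v (g.coe_mem_sector hv) := by
      apply Subtype.ext
      exact Finsupp.mapRange_single (hf := map_zero g.fixedSpace.subtype)
    rw [e]
    refine Automorphism.IsMonomial.mul (g := g) d q v _ ?_ μ _ ih
    unfold VertexOperatorAlgebra.weightSpace at *
    rw [Module.End.mem_eigenspace_iff] at *
    exact congrArg Subtype.val hd

theorem Automorphism.inclU_mem_gradedU {μ : ℚ} {x : g.onFixed.U} (hx : x ∈ g.onFixed.gradedU μ) :
    g.inclU x ∈ g.gradedU μ := by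
  induction hx using Submodule.span_induction with
  | zero => rw [map_zero]; exact Submodule.zero_mem _
  | add x y _ _ hx hy => rw [map_add]; exact Submodule.add_mem _ hx hy
  | smul c x _ hx => rw [map_smul]; exact Submodule.smul_mem _ c hx
  | mem x hx =>
    obtain ⟨x, hx, rfl⟩ := hx
    exact Submodule.subset_span ⟨_, hx.incl, rfl⟩

variable (g)

/-- The coefficientwise extension to power series. -/
def Automorphism.inclSeries : PowerSeries g.onFixed.U →ₐ[ℂ] PowerSeries g.U :=
  PowerSeries.mapAlgHom g.inclU

theorem Automorphism.coeff_inclSeries (f : PowerSeries g.onFixed.U) (i : ℕ) :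
    PowerSeries.coeff i (g.inclSeries f) = g.inclU (PowerSeries.coeff i f) := rfl

theorem Automorphism.inclSeries_mem_series {f : PowerSeries g.onFixed.U}
    (hf : f ∈ g.onFixed.series) : g.inclSeries f ∈ g.series := by
  change f ∈ ⨆ μ : ℚ, g.onFixed.gradedSeries μ at hf
  change g.inclSeries f ∈ ⨆ μ : ℚ, g.gradedSeries μ
  induction hf using Submodule.iSup_induction' with
  | zero => rw [map_zero]; exact Submodule.zero_mem _
  | add x y _ _ hx hy => rw [map_add]; exact Submodule.add_mem _ hx hy
  | mem μ x hx => exact Submodule.mem_iSup_of_mem μ fun i => inclU_mem_gradedU (hx i)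

theorem Automorphism.inclSeries_mem_algC {f : PowerSeries g.onFixed.U}
    (hf : f ∈ g.onFixed.algC) : g.inclSeries f ∈ g.algC :=
  ⟨g.inclSeries_mem_series hf.1, fun M _ _ Y m => by
    have := hf.2 M Y.restrict m
    simp only [Y.actionU_restrict] at this
    exact this⟩

/-- The induced homomorphism between the algebras `C` of `V⁰` and of `(V, g)`. -/
def Automorphism.inclC : g.onFixed.algC →ₐ[ℂ] g.algC :=
  (g.inclSeries.comp g.onFixed.algC.val).codRestrict g.algC
    fun f => g.inclSeries_mem_algC f.2

variable {g} in
theorem TwistedModule.actionC_restrict {M : Type u} [AddCommGroup M] [Module ℂ M]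
    (Y : TwistedModule g M) (f : g.onFixed.algC) :
    Y.restrict.actionC f = Y.actionC (g.inclC f) := by
  refine LinearMap.ext fun m => ?_
  change ∑ᶠ i : ℕ, _ = ∑ᶠ i : ℕ, _
  refine finsum_congr fun i => ?_
  rw [Y.actionU_restrict]
  rfl

/-- The homomorphism `ψ̄ : A(V⁰) → A(g)` induced by the inclusion `V⁰ ⊆ V`. -/
def Automorphism.psi : g.onFixed.A →ₐ[ℂ] g.A :=
  Ideal.Quotient.liftₐ g.onFixed.annC (g.toA.comp g.inclC) fun x hx => by
    refine Ideal.Quotient.eq_zero_iff_mem.mpr ?_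
    intro M _ _ Y
    exact (Y.actionC_restrict x).symm.trans (hx M Y.restrict)

end Psi

/-! ### The functor `𝓕` and induction -/

section Induction

variable {V : Type u} [AddCommGroup V] [Module ℂ V] {𝒱 : VertexOperatorAlgebra V}

/-- The left ideal `Ann_{A(g)}(m)`. -/
def TwistedModule.annihilator {g : 𝒱.Automorphism} {M : Type u} [AddCommGroup M] [Module ℂ M]
    (Y : TwistedModule g M) (m : M) : Ideal g.A where
  carrier := {a | Y.action a m = 0}
  add_mem' {a b} ha hb := by
    simp only [Set.mem_ofPred_eq] at *
    rw [map_add, LinearMap.add_apply, ha, hb, add_zero]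
  zero_mem' := by
    simp only [Set.mem_ofPred_eq, map_zero, LinearMap.zero_apply]
  smul_mem' c a ha := by
    simp only [Set.mem_ofPred_eq] at *
    rw [smul_eq_mul, map_mul, Module.End.mul_apply, ha, map_zero]

theorem TwistedModule.loopAction_apply {g : 𝒱.Automorphism} {M : Type u} [AddCommGroup M]
    [Module ℂ M] (Y : TwistedModule g M) (x : g.loopSpace) (m : M) :
    Y.loopAction x m = ∑ q ∈ x.1.support, Y.mode q (x.1 q) m := by
  change (Finsupp.sum x.1 fun q v => Y.mode q v) m = _
  rw [Finsupp.sum, LinearMap.sum_apply]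

theorem TwistedModule.tensorAction_prod {g : 𝒱.Automorphism} {M N : Type u} [AddCommGroup M]
    [Module ℂ M] [AddCommGroup N] [Module ℂ N] (Y : TwistedModule g M) (Z : TwistedModule g N)
    (x : TensorAlgebra ℂ g.loopSpace) : ∀ p : M × N,
    (Y.prod Z).tensorAction x p = (Y.tensorAction x p.1, Z.tensorAction x p.2) := by
  induction x using TensorAlgebra.induction with
  | algebraMap r => intro p; simp only [AlgHom.commutes]; rfl
  | ι x =>
    intro p
    simp only [TwistedModule.tensorAction, TensorAlgebra.lift_ι_apply, loopAction_apply]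
    refine Prod.ext ?_ ?_
    · rw [Prod.fst_sum]; rfl
    · rw [Prod.snd_sum]; rfl
  | mul a b ha hb =>
    intro p
    simp only [map_mul, Module.End.mul_apply]
    rw [hb, ha]
  | add a b ha hb =>
    intro p
    simp only [map_add, LinearMap.add_apply]
    rw [ha, hb]
    rfl

theorem TwistedModule.action_prod {g : 𝒱.Automorphism} {M N : Type u} [AddCommGroup M]
    [Module ℂ M] [AddCommGroup N] [Module ℂ N] (Y : TwistedModule g M) (Z : TwistedModule g N)
    (a : g.A) (m : M) (n : N) :
    (Y.prod Z).action a (m, n) = (Y.action a m, Z.action a n) := by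
  obtain ⟨f, rfl⟩ := Ideal.Quotient.mk_surjective a
  have hU : ∀ x : g.U, (Y.prod Z).actionU x (m, n) = (Y.actionU x m, Z.actionU x n) := by
    intro x
    obtain ⟨x, rfl⟩ := Ideal.Quotient.mk_surjective x
    exact Y.tensorAction_prod Z x (m, n)
  have hs := f.2.2 _ (Y.prod Z) (m, n)
  refine Prod.ext ?_ ?_
  · refine ((LinearMap.fst ℂ M N).toAddMonoidHom.map_finsum hs).trans ?_
    exact finsum_congr fun i => congrArg Prod.fst (hU _)
  · refine ((LinearMap.snd ℂ M N).toAddMonoidHom.map_finsum hs).trans ?_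
    exact finsum_congr fun i => congrArg Prod.snd (hU _)

/-- The collection `𝓛_g` of the left ideals `Ann_{A(g)}(m)`, for `m` in a `g`-twisted module. -/
def Automorphism.annihilators (g : 𝒱.Automorphism) : Set (Ideal g.A) :=
  {J | ∃ (M : Type u) (_ : AddCommGroup M) (_ : Module ℂ M) (Y : TwistedModule g M) (m : M),
    J = Y.annihilator m}

/-- `𝓕(X)`: the elements of the `A(g)`-module `X` that are killed by some `J ∈ 𝓛_g`. -/
def Automorphism.smoothPart (g : 𝒱.Automorphism) (X : Type u) [AddCommGroup X] [Module g.A X] :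
    Submodule g.A X where
  carrier := {x | ∃ J ∈ g.annihilators, ∀ a ∈ J, a • x = 0}
  add_mem' := by
    rintro x y ⟨_, ⟨M, _, _, Y, m, rfl⟩, hx⟩ ⟨_, ⟨N, _, _, Z, n, rfl⟩, hy⟩
    refine ⟨_, ⟨M × N, _, _, Y.prod Z, (m, n), rfl⟩, fun a ha => ?_⟩
    have key := Y.action_prod Z a m n
    have h0 : (Y.action a m, Z.action a n) = (0 : M × N) := key.symm.trans ha
    rw [smul_add, hx a (congrArg Prod.fst h0), hy a (congrArg Prod.snd h0), add_zero]
  zero_mem' := ⟨_, ⟨PUnit, _, _, TwistedModule.zero g, PUnit.unit, rfl⟩, fun a _ => smul_zero a⟩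
  smul_mem' := by
    rintro b x ⟨_, ⟨M, _, _, Y, m, rfl⟩, hx⟩
    refine ⟨_, ⟨M, _, _, Y, Y.action b m, rfl⟩, fun a ha => ?_⟩
    rw [smul_smul]
    refine hx _ ?_
    change Y.action (a * b) m = 0
    rw [map_mul]
    exact ha

variable (g : 𝒱.Automorphism) {N : Type u} [AddCommGroup N] [Module ℂ N]

/-- `Hom_{A(V⁰)}(A(g), N)` for an `A(V⁰)`-module `N`, given by `σ : A(V⁰) → End N`; `A(g)` is a left
`A(V⁰)`-module through `ψ̄`. -/
def Automorphism.homSpace (σ : g.onFixed.A →ₐ[ℂ] Module.End ℂ N) :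
    Submodule ℂ (g.A →ₗ[ℂ] N) where
  carrier := {f | ∀ (a : g.onFixed.A) (x : g.A), f (g.psi a * x) = σ a (f x)}
  add_mem' hf hh a x := by rw [LinearMap.add_apply, LinearMap.add_apply, hf, hh, map_add]
  zero_mem' a x := by rw [LinearMap.zero_apply, LinearMap.zero_apply, map_zero]
  smul_mem' c f hf a x := by rw [LinearMap.smul_apply, LinearMap.smul_apply, hf, map_smul]

/-- `Hom_{A(V⁰)}(A(g), N)` as a type, carrying the `A(g)`-action `(a f)(x) = f(x a)`. -/
def Automorphism.Coind (σ : g.onFixed.A →ₐ[ℂ] Module.End ℂ N) : Type u := g.homSpace σ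

instance (σ : g.onFixed.A →ₐ[ℂ] Module.End ℂ N) : AddCommGroup (g.Coind σ) :=
  inferInstanceAs (AddCommGroup (g.homSpace σ))

instance (σ : g.onFixed.A →ₐ[ℂ] Module.End ℂ N) : Module ℂ (g.Coind σ) :=
  inferInstanceAs (Module ℂ (g.homSpace σ))

instance (σ : g.onFixed.A →ₐ[ℂ] Module.End ℂ N) : Module g.A (g.Coind σ) where
  smul b f := ⟨f.1 ∘ₗ LinearMap.mulRight ℂ b, fun a x => by
    change f.1 (g.psi a * x * b) = σ a (f.1 (x * b))
    rw [mul_assoc]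
    exact f.2 a (x * b)⟩
  one_smul f := Subtype.ext (LinearMap.ext fun x => congrArg f.1 (mul_one x))
  mul_smul b c f := Subtype.ext (LinearMap.ext fun x => congrArg f.1 (mul_assoc x b c).symm)
  smul_zero b := Subtype.ext (LinearMap.ext fun x => rfl)
  smul_add b f h := Subtype.ext (LinearMap.ext fun x => rfl)
  add_smul b c f := Subtype.ext (LinearMap.ext fun x =>
    (congrArg f.1 (mul_add x b c)).trans (map_add f.1 _ _))
  zero_smul f := Subtype.ext (LinearMap.ext fun x =>
    (congrArg f.1 (mul_zero x)).trans (map_zero f.1))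

/-- The induced module `Ind N = 𝓕(Hom_{A(V⁰)}(A(g), N))` of a `V⁰`-module `N`. -/
def Automorphism.Ind (W : TwistedModule g.onFixed N) : Submodule g.A (g.Coind W.action) :=
  g.smoothPart (g.Coind W.action)

end Induction

/-! ### Isomorphisms and the socle -/

section Socle

variable {V : Type u} [AddCommGroup V] [Module ℂ V] {𝒱 : VertexOperatorAlgebra V}
  {g : 𝒱.Automorphism}

/-- A `g`-twisted module `M`, as a module over `A(g)`. -/
def TwistedModule.Carrier {M : Type u} [AddCommGroup M] [Module ℂ M] (_ : TwistedModule g M) :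
    Type u := M

instance {M : Type u} [AddCommGroup M] [Module ℂ M] (Y : TwistedModule g M) :
    AddCommGroup Y.Carrier := inferInstanceAs (AddCommGroup M)

instance {M : Type u} [AddCommGroup M] [Module ℂ M] (Y : TwistedModule g M) :
    Module g.A Y.Carrier where
  smul a m := Y.action a m
  one_smul m := congrArg (fun f : Module.End ℂ M => f m) (map_one Y.action)
  mul_smul a b m := congrArg (fun f : Module.End ℂ M => f m) (map_mul Y.action a b)
  smul_zero a := map_zero (Y.action a)
  smul_add a := map_add (Y.action a)
  add_smul a b m := congrArg (fun f : Module.End ℂ M => f m) (map_add Y.action a b)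
  zero_smul m := congrArg (fun f : Module.End ℂ M => f m) (map_zero Y.action)

end Socle

/-- The socle of a module: the sum of its simple submodules, i.e. its largest semisimple
submodule. -/
def socle (R : Type*) [Ring R] (X : Type*) [AddCommGroup X] [Module R X] : Submodule R X :=
  sSup {S : Submodule R X | IsSimpleModule R S}

/-- `D` is a decomposition of the submodule `T` into a direct sum of simple submodules. -/
def IsSimpleDecomposition {R : Type*} [Ring R] {X : Type*} [AddCommGroup X] [Module R X]
    (T : Submodule R X) (D : Set (Submodule R X)) : Prop :=
  (∀ S ∈ D, IsSimpleModule R S) ∧ sSupIndep D ∧ sSup D = T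

end VertexOperatorAlgebra

end

/-! Let π : M → M^r be the projection killing the weights outside μ - r/K + ℤ. It is V⁰-linear, so m
↦ (x ↦ π(xm)) is an A(g)-homomorphism M → Ind M^r (`toInd`). All claims follow once this map is
injective and its image S is essential, in the sense that every nonzero t in Ind M^r has a nonzero
multiple at in S. For M is simple over A(g), so S is simple; a simple submodule meeting S
nontrivially is S; hence S is the only simple submodule and equals the socle.

Injectivity (`toInd_injective`). As M is simple, the map need only be nonzero, and for m in M^r its
value at x = 1 is m. So the point is M^r ≠ 0 (`weightClass_ne_bot`). Simplicity of V gives Y(v,z)w ≠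
0 for nonzero v, w (`exists_mode_ne_zero`), so a nonzero v in V^i carries a nonzero M^r to a nonzero
M^(r+i). The periods of {r : M^r ≠ 0} form a subgroup of ℤ containing K and every i with V^i ≠ 0;
since g has order exactly K, it is ℤ.

Essentiality (`exists_smul_eq_toInd`). Let f be a nonzero element of Ind M^r, killed by Ann(w). Then
f(a) depends only on aw, which yields a V⁰-homomorphism h : A(g)w → M^r. It commutes with L(0), so
projecting to the weights in μ - r/K + ℤ produces w₀ in A(g)w, with weights in that class and h(w₀)
≠ 0. The key identity is h(aw₀) = π(a h(w₀)) for all a in A(g), although h is only V⁰-linear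
(`map_action_eq_componentProj`). By the Jacobi identity, A(g) applied to the pair (w₀, h(w₀)) is
spanned by vectors obtained from it by a single mode (`action_mem_of_mode_mem`). An integral mode
sees only the g-fixed part of its vector, with which h commutes; a nonintegral mode leaves the
weight class, so both sides vanish. Writing w₀ = a₁w, the identity says that a₁f is the image of
h(w₀). -/

noncomputable section

namespace VertexOperatorAlgebra

/-! ### Eigenspaces of a finite order automorphism -/

section Sectors

variable {V : Type u} [AddCommGroup V] [Module ℂ V] {𝒱 : VertexOperatorAlgebra V}

theorem Automorphism.mem_sector {g : 𝒱.Automorphism} {s : ℚ} {v : V} :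
    v ∈ g.sector s ↔ g.toEquiv v = Complex.exp (2 * Real.pi * Complex.I * (s : ℂ)) • v :=
  Module.End.mem_eigenspace_iff

theorem Automorphism.sector_add_int (g : 𝒱.Automorphism) (s : ℚ) (k : ℤ) :
    g.sector (s + k) = g.sector s := by
  unfold sector
  congr 1
  push_cast
  rw [mul_add, Complex.exp_add, mul_comm _ (k : ℂ), Complex.exp_int_mul_two_pi_mul_I, mul_one]

theorem Automorphism.mem_fixedSpace_iff_sector_zero {g : 𝒱.Automorphism} {v : V} :
    v ∈ g.fixedSpace ↔ v ∈ g.sector 0 := by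
  rw [mem_sector, mem_fixedSpace]
  simp

theorem Automorphism.pow_apply_of_mem_sector {g : 𝒱.Automorphism} {s : ℚ} {v : V}
    (hv : v ∈ g.sector s) (n : ℕ) :
    (g.toEquiv ^ n) v = Complex.exp (2 * Real.pi * Complex.I * ((n * s : ℚ) : ℂ)) • v := by
  induction n with
  | zero => simp
  | succ n ih =>
    rw [pow_succ', LinearEquiv.mul_apply, ih, map_smul, mem_sector.mp hv, smul_smul,
      ← Complex.exp_add]
    congr 2
    push_cast
    ring

/-- The decomposition of a vector into eigenvectors of a finite order automorphism; the components
lie in every `g`-stable subspace containing the vector. -/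
theorem Automorphism.exists_sum_sector (g : 𝒱.Automorphism) (hg : IsOfFinOrder g.toEquiv) (v : V) :
    ∃ w : ℕ → V, (∀ i : ℕ, w i ∈ g.sector ((i : ℚ) / (orderOf g.toEquiv : ℚ))) ∧
      ∑ i ∈ Finset.range (orderOf g.toEquiv), w i = v ∧
      ∀ P : Submodule ℂ V, (∀ x ∈ P, g.toEquiv x ∈ P) → v ∈ P → ∀ i, w i ∈ P := by
  set K := orderOf g.toEquiv with hK
  have hK0 : K ≠ 0 := (orderOf_pos_iff.mpr hg).ne'
  have hKc : (K : ℂ) ≠ 0 := Nat.cast_ne_zero.mpr hK0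
  have hζ := Complex.isPrimitiveRoot_exp K hK0
  set ζ := Complex.exp (2 * Real.pi * Complex.I / K) with hζdef
  have hζ0 : ζ ≠ 0 := Complex.exp_ne_zero _
  have hgK : (g.toEquiv ^ K) = 1 := pow_orderOf_eq_one _
  -- The usual projectors of the cyclic group generated by g: average the g^j v against the
  -- character j ↦ ζ^(-ij).
  refine ⟨fun i => (K : ℂ)⁻¹ • ∑ j ∈ Finset.range K, (ζ⁻¹ ^ i) ^ j • (g.toEquiv ^ j) v,
    fun i => ?_, ?_, fun P hP hv i => ?_⟩
  · rw [mem_sector, map_smul, smul_comm]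
    congr 1
    have e : Complex.exp (2 * Real.pi * Complex.I * (((i : ℚ) / (K : ℚ) : ℚ) : ℂ)) = ζ ^ i := by
      rw [hζdef, ← Complex.exp_nat_mul]
      congr 1
      push_cast
      ring
    rw [e]
    have h : ∀ j, g.toEquiv ((ζ⁻¹ ^ i) ^ j • (g.toEquiv ^ j) v)
        = ζ ^ i • ((ζ⁻¹ ^ i) ^ (j + 1) • (g.toEquiv ^ (j + 1)) v) := fun j => by
      rw [map_smul, smul_smul, pow_succ' g.toEquiv, LinearEquiv.mul_apply, pow_succ', ← mul_assoc,
        ← mul_pow, mul_inv_cancel₀ hζ0, one_pow, one_mul]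
    rw [map_sum, Finset.sum_congr rfl fun j _ => h j, ← Finset.smul_sum]
    congr 1
    have hp : (ζ⁻¹ ^ i) ^ K = 1 := by
      rw [← pow_mul, mul_comm i K, pow_mul, inv_pow, hζ.pow_eq_one, inv_one, one_pow]
    -- The cyclic shift leaves the sum unchanged: expand the sum over j ≤ K at both ends, where the
    -- terms j = 0 and j = K agree.
    have h1 := Finset.sum_range_succ (fun j => (ζ⁻¹ ^ i) ^ j • (g.toEquiv ^ j) v) K
    rw [Finset.sum_range_succ', hgK, hp, pow_zero, pow_zero] at h1
    exact add_right_cancel h1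
  -- Orthogonality of characters: after exchanging the sums, the coefficient of g^j v is a geometric
  -- sum, which vanishes unless j = 0.
  · rw [← Finset.smul_sum, Finset.sum_comm, inv_smul_eq_iff₀ hKc]
    rw [Finset.sum_eq_single_of_mem 0 (Finset.mem_range.mpr (Nat.pos_of_ne_zero hK0))]
    · simp [Nat.cast_smul_eq_nsmul]
    · intro j hj hj0
      rw [← Finset.sum_smul]
      have h1 : ζ⁻¹ ^ j ≠ 1 := fun h => by
        rw [inv_pow, inv_eq_one] at h
        have := Nat.le_of_dvd (Nat.pos_of_ne_zero hj0) (hζ.dvd_of_pow_eq_one j h)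
        have := Finset.mem_range.mp hj
        omega
      have h2 := mul_geom_sum (ζ⁻¹ ^ j) K
      rw [← pow_mul, mul_comm j K, pow_mul, inv_pow ζ K, hζ.pow_eq_one, inv_one, one_pow,
        sub_self] at h2
      have h3 := (mul_eq_zero.mp h2).resolve_left (sub_ne_zero.mpr h1)
      simp only [← pow_mul] at h3 ⊢
      simp only [mul_comm j] at h3
      rw [h3, zero_smul]
  · refine P.smul_mem _ (P.sum_mem fun j hj => P.smul_mem _ ?_)
    clear hj
    induction j with
    | zero => simpa using hv
    | succ j ih => rw [pow_succ', LinearEquiv.mul_apply]; exact hP _ ih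

theorem Automorphism.map_mem_weightSpace (g : 𝒱.Automorphism) {d : ℤ} {v : V}
    (hv : v ∈ 𝒱.weightSpace d) : g.toEquiv v ∈ 𝒱.weightSpace d := by
  unfold VertexOperatorAlgebra.weightSpace at *
  rw [Module.End.mem_eigenspace_iff] at *
  have := g.map_mode 1 𝒱.conf v
  rw [hv, g.map_conf, map_smul] at this
  exact this.symm

theorem mem_iSup_weightSpace (v : V) : v ∈ ⨆ d : ℤ, 𝒱.weightSpace d := by
  have h : ⨆ d : ℤ, 𝒱.weightSpace d = ⊤ := 𝒱.grading
  rw [h]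
  exact Submodule.mem_top

/-- Induction over homogeneous eigenvectors. -/
theorem Automorphism.induction_sector (g : 𝒱.Automorphism) (hg : IsOfFinOrder g.toEquiv)
    {p : V → Prop} (h0 : p 0) (hadd : ∀ x y, p x → p y → p (x + y))
    (hs : ∀ (i : ℕ) (d : ℤ) (x : V), i < orderOf g.toEquiv →
      x ∈ g.sector ((i : ℚ) / (orderOf g.toEquiv : ℚ)) →
      x ∈ 𝒱.weightSpace d → p x) (v : V) : p v := by
  have hv := mem_iSup_weightSpace (𝒱 := 𝒱) v
  induction hv using Submodule.iSup_induction' with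
  | zero => exact h0
  | add x y _ _ hx hy => exact hadd x y hx hy
  | mem d x hx =>
    obtain ⟨w, hw, hsum, hP⟩ := g.exists_sum_sector hg x
    rw [← hsum]
    refine Finset.sum_induction _ p hadd h0 fun i hi => hs i d _ (Finset.mem_range.mp hi) (hw i) ?_
    exact hP _ (fun y hy => g.map_mem_weightSpace hy) hx i

/-- An integral mode of `v` depends only on the `g`-invariant part of `v`. -/
theorem Automorphism.exists_fixed (g : 𝒱.Automorphism) (hg : IsOfFinOrder g.toEquiv) (v : V) :
    ∃ v₀ ∈ g.fixedSpace, ∀ (M : Type u) [AddCommGroup M] [Module ℂ M] (Y : TwistedModule g M)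
      (k : ℤ), Y.mode k v = Y.mode k v₀ := by
  have hK0 : 0 < orderOf g.toEquiv := orderOf_pos_iff.mpr hg
  obtain ⟨w, hw, hsum, -⟩ := g.exists_sum_sector hg v
  refine ⟨w 0, mem_fixedSpace_iff_sector_zero.mpr (by simpa using hw 0), fun M _ _ Y k => ?_⟩
  rw [← hsum, map_sum]
  refine Finset.sum_eq_single_of_mem 0 (Finset.mem_range.mpr hK0) fun i hi hi0 => ?_
  refine Y.mode_support _ _ _ (hw i) ?_
  rintro ⟨l, hl⟩
  have hKq : (orderOf g.toEquiv : ℚ) ≠ 0 := Nat.cast_ne_zero.mpr hK0.ne'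
  have h1 : ((i : ℤ) : ℚ) = (((k - l) * (orderOf g.toEquiv : ℤ) : ℤ) : ℚ) := by
    push_cast
    rw [hl]
    field_simp
    ring
  have h2 : (i : ℤ) = (k - l) * (orderOf g.toEquiv : ℤ) := by exact_mod_cast h1
  -- A nonzero component with 0 < i < K has modes only in i/K + ℤ, which contains no integer.
  have h3 : (orderOf g.toEquiv : ℤ) ∣ i := ⟨k - l, by rw [h2, mul_comm]⟩
  have := Nat.le_of_dvd (Nat.pos_of_ne_zero hi0) (Int.natCast_dvd_natCast.mp h3)
  have := Finset.mem_range.mp hi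
  omega

end Sectors

/-! ### Modes as elements of A(g), and compatibility of the A(g)-action with maps -/

section Action

variable {V : Type u} [AddCommGroup V] [Module ℂ V] {𝒱 : VertexOperatorAlgebra V}

/-- Every mode is the action of an element of `A(g)`. -/
theorem Automorphism.exists_action_eq_mode (g : 𝒱.Automorphism) (hg : IsOfFinOrder g.toEquiv)
    (n : ℚ) (v : V) : ∃ a : g.A, ∀ (M : Type u) [AddCommGroup M] [Module ℂ M]
      (Y : TwistedModule g M), Y.action a = Y.mode n v := by
  induction v using g.induction_sector hg with
  | h0 => exact ⟨0, fun M _ _ Y => by rw [map_zero, map_zero]⟩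
  | hadd x y hx hy =>
    obtain ⟨a, ha⟩ := hx
    obtain ⟨b, hb⟩ := hy
    exact ⟨a + b, fun M _ _ Y => by rw [map_add, map_add, ha, hb]⟩
  | hs i d x _ hx hd =>
    by_cases hn : ∃ k : ℤ, n = (i : ℚ) / (orderOf g.toEquiv : ℚ) + k
    · have hx' : x ∈ g.sector n := by
        obtain ⟨k, rfl⟩ := hn
        rwa [g.sector_add_int]
      -- The constant series at x ⊗ t^n is homogeneous of degree d - n - 1 and is trivially
      -- summable.
      have hmem : PowerSeries.C (g.toU (TensorAlgebra.ι ℂ (g.tens n x hx'))) ∈ g.algC := by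
        refine ⟨?_, fun M _ _ Y => TwistedModule.Summable.C Y _⟩
        refine Submodule.mem_iSup_of_mem ((d : ℚ) - n - 1 + 0) fun i => ?_
        rw [PowerSeries.coeff_C]
        split_ifs
        · exact Submodule.subset_span ⟨_, .mul d n x hx' hd 0 1 .one, by rw [mul_one]⟩
        · exact Submodule.zero_mem _
      refine ⟨g.toA ⟨_, hmem⟩, fun M _ _ Y => LinearMap.ext fun m => ?_⟩
      refine (Y.value_C _ m).trans ?_
      rw [Y.actionU_toU, TwistedModule.tensorAction, TensorAlgebra.lift_ι_apply]
      exact congrArg (fun f : Module.End ℂ M => f m)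
        (Finsupp.sum_single_index (h := fun q v => Y.mode q v) (map_zero (Y.mode n)))
    · exact ⟨0, fun M _ _ Y => by rw [map_zero, Y.mode_support _ _ _ hx hn]⟩

namespace TwistedModule

variable {g : 𝒱.Automorphism} {M : Type u} [AddCommGroup M] [Module ℂ M] {N : Type u}
  [AddCommGroup N] [Module ℂ N]

/-- On any one vector, an element of A(g) acts by a finite sum of elements of U_g(V), hence by a
combination of products of modes. -/
theorem action_mem (Y : TwistedModule g M) (P : Submodule ℂ M)
    (hP : ∀ (n : ℚ) (v : V), ∀ x ∈ P, Y.mode n v x ∈ P) (a : g.A) {x : M} (hx : x ∈ P) :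
    Y.action a x ∈ P := by
  have hT : ∀ (b : TensorAlgebra ℂ g.loopSpace), ∀ x ∈ P, Y.tensorAction b x ∈ P := by
    intro b
    induction b using TensorAlgebra.induction with
    | algebraMap r =>
      intro x hx
      rw [AlgHom.commutes]
      exact P.smul_mem r hx
    | ι y =>
      intro x hx
      rw [tensorAction, TensorAlgebra.lift_ι_apply, loopAction_apply]
      exact P.sum_mem fun q _ => hP _ _ _ hx
    | mul a b ha hb =>
      intro x hx
      rw [map_mul]
      exact ha _ (hb _ hx)
    | add a b ha hb =>
      intro x hx
      rw [map_add]
      exact P.add_mem (ha _ hx) (hb _ hx)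
  have hU : ∀ b : g.U, Y.actionU b x ∈ P := fun b => by
    obtain ⟨b, rfl⟩ := Ideal.Quotient.mk_surjective b
    exact hT b x hx
  obtain ⟨f, rfl⟩ := Ideal.Quotient.mk_surjective a
  exact finsum_induction (· ∈ P) P.zero_mem (fun _ _ => P.add_mem) fun i => hU _

/-- A linear map commuting with all modes commutes with `A(g)`. -/
theorem map_action (Y : TwistedModule g M) (Z : TwistedModule g N) (φ : M →ₗ[ℂ] N)
    (hφ : ∀ (n : ℚ) (v : V) (x : M), φ (Y.mode n v x) = Z.mode n v (φ x)) (a : g.A) (x : M) :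
    φ (Y.action a x) = Z.action a (φ x) := by
  -- The graph of φ is a subspace of the direct sum stable under all modes, hence under A(g).
  have h := (Y.prod Z).action_mem φ.graph (fun n v p hp => by
    rw [LinearMap.mem_graph_iff] at *
    change Z.mode n v p.2 = φ (Y.mode n v p.1)
    rw [hφ, hp]) a (x := (x, φ x)) (by rw [LinearMap.mem_graph_iff])
  rw [action_prod, LinearMap.mem_graph_iff] at h
  exact h.symm

theorem action_restrict (Y : TwistedModule g M) (b : g.onFixed.A) :
    Y.restrict.action b = Y.action (g.psi b) := by
  obtain ⟨f, rfl⟩ := Ideal.Quotient.mk_surjective b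
  exact Y.actionC_restrict f

end TwistedModule

end Action

/-! ### Consequences of the Jacobi identity: products of modes, and nonvanishing of Y(v,z)w -/

section Span

/-- Used to solve a component of the Jacobi identity for its leading term when the other terms are
known to lie in P. -/
theorem mem_of_finsum_mem {W : Type*} [AddCommGroup W] [Module ℂ W] (P : Submodule ℂ W)
    {F : ℕ → W} (hF : (Function.support F).Finite) (hsum : ∑ᶠ m, F m ∈ P)
    (h : ∀ m, m ≠ 0 → F m ∈ P) : F 0 ∈ P := by
  have e : F = fun m => (if m = 0 then F 0 else 0) + (if m = 0 then 0 else F m) := by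
    funext m
    by_cases hm : m = 0 <;> simp [hm]
  rw [e, finsum_add_distrib, finsum_eq_single _ 0 fun m hm => if_neg hm, if_pos rfl] at hsum
  · refine (P.add_mem_iff_left ?_).mp hsum
    refine finsum_induction (· ∈ P) P.zero_mem (fun _ _ => P.add_mem) fun m => ?_
    split_ifs with hm
    · exact P.zero_mem
    · exact h m hm
  · refine (Set.finite_singleton 0).subset fun m hm => ?_
    by_contra hne
    exact hm (if_neg hne)
  · refine hF.subset fun m hm hz => hm ?_
    simp [hz]

variable {V : Type u} [AddCommGroup V] [Module ℂ V] {𝒱 : VertexOperatorAlgebra V}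
  {g : 𝒱.Automorphism}

namespace TwistedModule

variable {M : Type u} [AddCommGroup M] [Module ℂ M]

/-- A product of two modes applied to `w` is a combination of single modes applied to `w`. -/
theorem mode_mode_mem (hg : IsOfFinOrder g.toEquiv) (Y : TwistedModule g M) {P : Submodule ℂ M}
    {w : M} (hP : ∀ n v, Y.mode n v w ∈ P) (a b : ℚ) (u v : V) :
    Y.mode a u (Y.mode b v w) ∈ P := by
  induction u using g.induction_sector hg with
  | h0 => simp
  | hadd x y hx hy =>
    rw [map_add, LinearMap.add_apply]
    exact P.add_mem hx hy
  | hs i _ u _ hu _ =>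
    by_cases hn : ∃ k : ℤ, a = (i : ℚ) / (orderOf g.toEquiv : ℚ) + k
    swap
    · rw [Y.mode_support _ _ _ hu hn]
      exact P.zero_mem
    have hua : u ∈ g.sector a := by
      obtain ⟨k, rfl⟩ := hn
      rwa [g.sector_add_int]
    clear hu hn
    obtain ⟨R₁, h₁⟩ := Y.truncation v w
    obtain ⟨R₂, h₂⟩ := Y.truncation u w
    -- Induction on the distance from b to the bound beyond which the modes of v kill w; a must
    -- vary, because the Jacobi identity trades v_b for v_(b+m) and u_a for u_(a-m).
    have key : ∀ (N : ℕ) (a b : ℚ), u ∈ g.sector a → R₁ ≤ b + N →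
        Y.mode a u (Y.mode b v w) ∈ P := by
      intro N
      induction N with
      | zero =>
        intro a b _ hb
        rw [h₁ b (by simpa using hb), map_zero]
        exact P.zero_mem
      | succ N ih =>
        intro a b ha hb
        -- With s = a + j past the truncation bound of u on w, all terms v_* u_(s+m) w vanish.
        -- Taking p = -j makes the term m = 0 on the left equal to u_a v_b w, while the right side
        -- consists of single modes on w.
        obtain ⟨j, hj⟩ := exists_nat_ge (R₂ - a)
        have ha' : u ∈ g.sector (a + j) := by
          have := g.sector_add_int a j
          rw [Int.cast_natCast] at this
          rwa [this]
        have hJ := Y.jacobi (a + j) u ha' v w (-j) b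
        have hsum : ∑ᶠ m : ℕ, ((Ring.choose (a + j) m : ℚ) : ℂ) •
            Y.mode (a + j + b - m) (𝒱.mode (-j + m) u v) w ∈ P :=
          finsum_induction (· ∈ P) P.zero_mem (fun _ _ => P.add_mem)
            fun m => P.smul_mem _ (hP _ _)
        rw [← hJ] at hsum
        have h0 := mem_of_finsum_mem P
          (finite_support_left Y.mode Y.truncation u v w (-j) (a + j) b) hsum fun m hm => by
            refine P.smul_mem _ (P.sub_mem ?_ (P.smul_mem _ ?_))
            · have e : (((-j : ℤ) : ℚ) + (a + j) - m) = a + ((-m : ℤ) : ℚ) := by push_cast; ring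
              rw [e]
              refine ih _ _ (by rwa [g.sector_add_int]) ?_
              have : (1 : ℚ) ≤ m := by exact_mod_cast Nat.one_le_iff_ne_zero.mpr hm
              push_cast at hb
              linarith
            · rw [h₂ _ (by have : (0 : ℚ) ≤ m := Nat.cast_nonneg m
                           linarith), map_zero]
              exact P.zero_mem
        rw [h₂ (a + j + (0 : ℕ)) (by push_cast; linarith), map_zero, smul_zero, sub_zero] at h0
        have e : (((-j : ℤ) : ℚ) + (a + j) - (0 : ℕ)) = a := by push_cast; ring
        simpa [e] using h0
    obtain ⟨N, hN⟩ := exists_nat_ge (R₁ - b)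
    exact key N a b hua (by linarith)

/-- `A(g) w` is spanned by the vectors `vₙ w`. -/
theorem action_mem_of_mode_mem (hg : IsOfFinOrder g.toEquiv) (Y : TwistedModule g M)
    {P : Submodule ℂ M} {w : M} (hP : ∀ n v, Y.mode n v w ∈ P) (a : g.A) : Y.action a w ∈ P := by
  let S : Submodule ℂ M := Submodule.span ℂ {y | ∃ n v, Y.mode n v w = y}
  have hS : ∀ n v, Y.mode n v w ∈ S := fun n v => Submodule.subset_span ⟨n, v, rfl⟩
  have hw : w ∈ S := by
    have h := Y.vacuum (-1) w
    rw [if_pos rfl] at h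
    rw [← h]
    exact hS _ _
  have hSP : S ≤ P := Submodule.span_le.mpr fun y ⟨n, v, h⟩ => h ▸ hP n v
  refine hSP (Y.action_mem S (fun n v x hx => ?_) a hw)
  induction hx using Submodule.span_induction with
  | zero => rw [map_zero]; exact S.zero_mem
  | add x y _ _ hx hy => rw [map_add]; exact S.add_mem hx hy
  | smul c x _ hx => rw [map_smul]; exact S.smul_mem c hx
  | mem x hx =>
    obtain ⟨b, v', rfl⟩ := hx
    exact Y.mode_mode_mem hg hS n b v v'

/-- If `V` is simple, then `Y(v, z) w ≠ 0` for nonzero `v` and `w`. -/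
theorem exists_mode_ne_zero (hV : 𝒱.IsSimple) (hg : IsOfFinOrder g.toEquiv)
    (Y : TwistedModule g M) {v : V} (hv : v ≠ 0) {w : M} (hw : w ≠ 0) :
    ∃ n, Y.mode n v w ≠ 0 := by
  by_contra! hcon
  let I : Submodule ℂ V :=
    { carrier := {v | ∀ n, Y.mode n v w = 0}
      add_mem' := fun {a b} ha hb n => by rw [map_add, LinearMap.add_apply, ha n, hb n, add_zero]
      zero_mem' := fun n => by rw [map_zero, LinearMap.zero_apply]
      smul_mem' := fun c a ha n => by rw [map_smul, LinearMap.smul_apply, ha n, smul_zero] }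
  -- The vectors all of whose modes kill w form an ideal of V. It contains v ≠ 0, hence by
  -- simplicity also the vacuum, whose mode -1 is the identity.
  have hI : ∀ (p : ℤ) (u : V), ∀ v ∈ I, 𝒱.mode p u v ∈ I := by
    intro p u v hvI
    induction u using g.induction_sector hg with
    | h0 =>
      rw [map_zero, LinearMap.zero_apply]
      exact I.zero_mem
    | hadd x y hx hy =>
      rw [map_add, LinearMap.add_apply]
      exact I.add_mem hx hy
    | hs i _ u _ hu _ =>
      obtain ⟨R, hR⟩ := 𝒱.truncation u v
      obtain ⟨R₂, h₂⟩ := Y.truncation u w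
      obtain ⟨j, hj⟩ := exists_nat_ge (R₂ - (i : ℚ) / (orderOf g.toEquiv : ℚ))
      have hu' : u ∈ g.sector ((i : ℚ) / (orderOf g.toEquiv : ℚ) + (j : ℤ)) := by
        rwa [g.sector_add_int]
      generalize hs : (i : ℚ) / (orderOf g.toEquiv : ℚ) + ((j : ℤ) : ℚ) = s at hu'
      have hs2 : R₂ ≤ s := by
        rw [← hs]
        push_cast
        linarith
      -- Descending induction on p from the truncation bound of u on v. Since s is at least the
      -- bound of u on w and v is in I, the left side of the Jacobi identity is zero; on the right
      -- the terms m ≥ 1 vanish by induction, leaving (u_p v)_n w = 0.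
      have key : ∀ (N : ℕ) (p : ℤ), R ≤ p + N → 𝒱.mode p u v ∈ I := by
        intro N
        induction N with
        | zero =>
          intro p hp
          rw [hR p (by simpa using hp)]
          exact I.zero_mem
        | succ N ih =>
          intro p hp n
          have hJ := Y.jacobi s u hu' v w p (n - s)
          have hl : ∀ m : ℕ, ((-1 : ℂ) ^ m * ((Ring.choose p m : ℤ) : ℂ)) •
              (Y.mode (p + s - m) u (Y.mode (n - s + m) v w)
                - (-1 : ℂ) ^ p • Y.mode (p + (n - s) - m) v (Y.mode (s + m) u w)) = 0 := fun m => by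
            rw [hvI, h₂ (s + m) (by have : (0 : ℚ) ≤ m := Nat.cast_nonneg m
                                    linarith)]
            simp
          rw [finsum_congr hl, finsum_zero] at hJ
          have h0 := mem_of_finsum_mem (⊥ : Submodule ℂ M)
            (finite_support_right (𝒱 := 𝒱) Y.mode u v w p s (n - s))
            (by rw [← hJ]; exact Submodule.zero_mem _) fun m hm => by
              rw [ih (p + m) (by push_cast at hp; omega), smul_zero]
              exact Submodule.zero_mem _
          rw [Submodule.mem_bot] at h0
          simpa using h0
      exact key (R - p).toNat p (by omega)
  rcases hV.2 I hI with h | h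
  · have : v ∈ I := hcon
    rw [h, Submodule.mem_bot] at this
    exact hv this
  · have : 𝒱.vac ∈ I := h ▸ Submodule.mem_top
    have h1 := this (-1)
    rw [Y.vacuum, if_pos rfl] at h1
    exact hw h1

end TwistedModule

end Span

/-! ### Weights modulo ℤ and the nonvanishing of every M^r -/

section Classes

variable {V : Type u} [AddCommGroup V] [Module ℂ V] {𝒱 : VertexOperatorAlgebra V}
  {g : 𝒱.Automorphism} {M : Type u} [AddCommGroup M] [Module ℂ M]

namespace TwistedModule

/-- The sum of the weight spaces `M_ν` with `ν ∈ c + ℤ`. -/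
def weightClass (Y : TwistedModule g M) (c : ℂ) : Submodule ℂ M := ⨆ n : ℤ, Y.weightSpace (c + n)

/-- The sum of the weight spaces `M_ν` with `ν ∉ c + ℤ`. -/
def weightCoclass (Y : TwistedModule g M) (c : ℂ) : Submodule ℂ M :=
  ⨆ ν ∈ {ν : ℂ | ∀ n : ℤ, ν ≠ c + n}, Y.weightSpace ν

/-- M is the direct sum of the eigenspaces of L(0), and their eigenvalues are partitioned into c + ℤ
and the rest. -/
theorem isCompl_weightClass (Y : TwistedModule g M) (c : ℂ) :
    IsCompl (Y.weightClass c) (Y.weightCoclass c) := by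
  have e : Y.weightClass c = ⨆ ν ∈ Set.range fun n : ℤ => c + n, Y.weightSpace ν := by
    rw [iSup_range]
    rfl
  constructor
  · rw [e]
    refine (Module.End.eigenspaces_iSupIndep (Y.mode 1 𝒱.conf)).disjoint_biSup_biSup ?_
    rw [Set.disjoint_left]
    rintro _ ⟨n, rfl⟩ h
    exact h n rfl
  · rw [codisjoint_iff, eq_top_iff]
    refine Y.grading.ge.trans (iSup_le fun ν => ?_)
    by_cases h : ∃ n : ℤ, ν = c + n
    · obtain ⟨n, rfl⟩ := h
      exact (le_iSup (fun n : ℤ => Y.weightSpace (c + n)) n).trans le_sup_left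
    · push Not at h
      exact (le_biSup Y.weightSpace (show ν ∈ {ν : ℂ | ∀ n : ℤ, ν ≠ c + n} from h)).trans le_sup_right

theorem weightClass_add_int (Y : TwistedModule g M) (c : ℂ) (k : ℤ) :
    Y.weightClass (c + k) = Y.weightClass c := by
  unfold weightClass
  refine (Equiv.addLeft k).iSup_congr fun n => ?_
  congr 1
  simp [add_assoc]

theorem weightClass_le_weightCoclass (Y : TwistedModule g M) {c c' : ℂ}
    (h : ∀ n : ℤ, c' ≠ c + n) : Y.weightClass c' ≤ Y.weightCoclass c := by
  refine iSup_le fun n => le_biSup Y.weightSpace (i := c' + n) fun k hk => h (k - n) ?_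
  push_cast
  linear_combination hk

/-- For homogeneous v the mode v_n shifts weights by wt v - n - 1, which is -n modulo ℤ whatever the
weight of v. -/
theorem mode_mem_weightClass (Y : TwistedModule g M) (n : ℚ) (v : V) {c : ℂ} {x : M}
    (hx : x ∈ Y.weightClass c) : Y.mode n v x ∈ Y.weightClass (c - n) := by
  have hv := mem_iSup_weightSpace (𝒱 := 𝒱) v
  induction hv using Submodule.iSup_induction' with
  | zero => simp
  | add a b _ _ ha hb =>
    rw [map_add, LinearMap.add_apply]
    exact Submodule.add_mem _ ha hb
  | mem d a ha =>
    unfold weightClass at hx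
    induction hx using Submodule.iSup_induction' with
    | zero => simp
    | add y z _ _ hy hz =>
      rw [map_add]
      exact Submodule.add_mem _ hy hz
    | mem l y hy =>
      refine Submodule.mem_iSup_of_mem (l + d - 1) ?_
      convert Y.mode_mem_weightSpace ha n hy using 2
      push_cast
      ring

theorem mode_mem_weightClass_int (Y : TwistedModule g M) (k : ℤ) (v : V) {c : ℂ} {x : M}
    (hx : x ∈ Y.weightClass c) : Y.mode k v x ∈ Y.weightClass c := by
  have h := Y.mode_mem_weightClass k v hx
  rw [← Y.weightClass_add_int _ k] at h
  simpa using h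

theorem mode_mem_weightCoclass (Y : TwistedModule g M) {n : ℚ} (hn : ∀ k : ℤ, n ≠ k) (v : V)
    {c : ℂ} {x : M} (hx : x ∈ Y.weightClass c) : Y.mode n v x ∈ Y.weightCoclass c := by
  refine Y.weightClass_le_weightCoclass (fun k hk => hn (-k) ?_) (Y.mode_mem_weightClass n v hx)
  have : (n : ℂ) = ((-k : ℤ) : ℂ) := by
    push_cast
    linear_combination -hk
  exact_mod_cast this

theorem mode_int_mem_weightCoclass (Y : TwistedModule g M) (k : ℤ) (v : V) {c : ℂ} {x : M}
    (hx : x ∈ Y.weightCoclass c) : Y.mode k v x ∈ Y.weightCoclass c := by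
  unfold weightCoclass at hx
  rw [iSup_subtype'] at hx
  induction hx using Submodule.iSup_induction' with
  | zero => simp
  | add y z _ _ hy hz =>
    rw [map_add]
    exact Submodule.add_mem _ hy hz
  | mem ν y hy =>
    have h : y ∈ Y.weightClass ν :=
      Submodule.mem_iSup_of_mem 0 (by rwa [Int.cast_zero, add_zero])
    exact Y.weightClass_le_weightCoclass (fun n => ν.2 n) (Y.mode_mem_weightClass_int k v h)

/-- The projection onto the weights in `c + ℤ`. -/
def weightProj (Y : TwistedModule g M) (c : ℂ) : M →ₗ[ℂ] M :=
  (Y.weightClass c).projection (Y.weightCoclass c) (Y.isCompl_weightClass c)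

theorem weightProj_mem (Y : TwistedModule g M) (c : ℂ) (x : M) :
    Y.weightProj c x ∈ Y.weightClass c :=
  Submodule.projection_apply_mem _ x

theorem weightProj_of_mem (Y : TwistedModule g M) {c : ℂ} {x : M} (hx : x ∈ Y.weightClass c) :
    Y.weightProj c x = x :=
  Submodule.projection_apply_left _ ⟨x, hx⟩

theorem weightProj_eq_zero_iff (Y : TwistedModule g M) {c : ℂ} {x : M} :
    Y.weightProj c x = 0 ↔ x ∈ Y.weightCoclass c :=
  Submodule.projection_apply_eq_zero_iff _

/-- Integral modes preserve both summands of the decomposition, so they commute with the projection.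
-/
theorem weightProj_mode_int (Y : TwistedModule g M) (c : ℂ) (k : ℤ) (v : V) (x : M) :
    Y.weightProj c (Y.mode k v x) = Y.mode k v (Y.weightProj c x) := by
  have h : x - Y.weightProj c x ∈ Y.weightCoclass c := Submodule.sub_projection_mem _ x
  have h1 := Y.weightProj_eq_zero_iff.mpr (Y.mode_int_mem_weightCoclass k v h)
  rw [map_sub, map_sub,
    Y.weightProj_of_mem (Y.mode_mem_weightClass_int k v (Y.weightProj_mem c x)), sub_eq_zero] at h1
  exact h1

/-- The classes `μ - r/K + ℤ` all occur among the weights of `M` if one of them does. -/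
theorem weightClass_ne_bot (hV : 𝒱.IsSimple) (hg : IsOfFinOrder g.toEquiv)
    (Y : TwistedModule g M) {μ : ℂ} (hμ : Y.weightSpace μ ≠ ⊥) (r : ℤ) :
    Y.weightClass (μ - (r : ℂ) / (orderOf g.toEquiv : ℂ)) ≠ ⊥ := by
  set K := orderOf g.toEquiv with hK
  have hK0 : 0 < K := orderOf_pos_iff.mpr hg
  have hKc : (K : ℂ) ≠ 0 := Nat.cast_ne_zero.mpr hK0.ne'
  let p : ℤ → Prop := fun r => Y.weightClass (μ - (r : ℂ) / (K : ℂ)) ≠ ⊥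
  have hp0 : p 0 := fun h => hμ (by
    rw [eq_bot_iff, ← h]
    refine fun x hx => Submodule.mem_iSup_of_mem 0 ?_
    simpa using hx)
  have hpK : ∀ r l : ℤ, p (r + K * l) ↔ p r := fun r l => by
    have e : μ - ((r + K * l : ℤ) : ℂ) / (K : ℂ) = μ - (r : ℂ) / (K : ℂ) + ((-l : ℤ) : ℂ) := by
      push_cast
      field_simp
      ring
    simp only [p]
    rw [e, Y.weightClass_add_int]
  have hpadd : ∀ (i : ℕ) (v : V), v ≠ 0 → v ∈ g.sector ((i : ℚ) / (K : ℚ)) →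
      ∀ r, p r → p (r + i) := by
    intro i v hv0 hv r hr
    obtain ⟨x, hx, hx0⟩ := (Submodule.ne_bot_iff _).mp hr
    obtain ⟨n, hn⟩ := Y.exists_mode_ne_zero hV hg hv0 hx0
    have hk : ∃ k : ℤ, n = (i : ℚ) / (K : ℚ) + k := by
      by_contra h
      rw [Y.mode_support _ _ _ hv h] at hn
      exact hn rfl
    obtain ⟨k, rfl⟩ := hk
    have hm := Y.mode_mem_weightClass ((i : ℚ) / (K : ℚ) + k) v hx
    refine (Submodule.ne_bot_iff _).mpr ⟨_, ?_, hn⟩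
    rw [← Y.weightClass_add_int _ k] at hm
    convert hm using 2
    push_cast
    ring
  -- The group of periods of the set of r for which the class μ - r/K + ℤ occurs. It will turn out
  -- to be all of ℤ, and the class r = 0 occurs.
  let H : AddSubgroup ℤ :=
    { carrier := {a | ∀ r, p (r + a) ↔ p r}
      add_mem' := fun {a b} ha hb r => by rw [← add_assoc, hb, ha]
      zero_mem' := fun r => by rw [add_zero]
      neg_mem' := fun {a} ha r => by rw [← ha (r + -a), neg_add_cancel_right] }
  have hHK : (K : ℤ) ∈ H := fun r => by simpa using hpK r 1
  have hHi : ∀ (i : ℕ) (v : V), v ≠ 0 → v ∈ g.sector ((i : ℚ) / (K : ℚ)) → (i : ℤ) ∈ H := by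
    intro i v hv0 hv r
    refine ⟨fun h => ?_, hpadd i v hv0 hv r⟩
    -- For the converse direction, K - 1 further shifts by i lead from r + i to r + Ki, which is
    -- equivalent to r by periodicity modulo K.
    have hmul : ∀ (j : ℕ) (r : ℤ), p r → p (r + j * i) := by
      intro j
      induction j with
      | zero => intro r hr; simpa using hr
      | succ j ih =>
        intro r hr
        have := hpadd i v hv0 hv _ (ih r hr)
        push_cast
        rwa [add_mul, one_mul, ← add_assoc]
    have h1 := hmul (K - 1) _ h
    rw [Nat.cast_sub hK0] at h1
    rw [← hpK r i]
    convert h1 using 1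
    push_cast
    ring
  obtain ⟨d, hd⟩ := Int.subgroup_cyclic H
  rw [← AddSubgroup.zmultiples_eq_closure] at hd
  rw [hd, Int.mem_zmultiples_iff] at hHK
  obtain ⟨e, he⟩ := Int.natAbs_dvd_natAbs.mpr hHK
  rw [Int.natAbs_natCast] at he
  -- If H = dℤ and K = |d|e, then every i with a nonzero component is a multiple of d, so g^e acts
  -- on that component by exp(2πi · ei/K) = 1. As K is the order of g, this forces |d| = 1.
  have hpow : g.toEquiv ^ e = 1 := by
    ext v
    obtain ⟨w, hw, hsum, -⟩ := g.exists_sum_sector hg v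
    rw [← hsum, map_sum, map_sum]
    refine Finset.sum_congr rfl fun i _ => ?_
    by_cases hi : w i = 0
    · rw [hi, map_zero, map_zero]
    have hdi := hHi i _ hi (hw i)
    rw [hd, Int.mem_zmultiples_iff] at hdi
    obtain ⟨q, hq⟩ := Int.natAbs_dvd_natAbs.mpr hdi
    rw [Int.natAbs_natCast] at hq
    have hee : ((e : ℚ) * ((i : ℚ) / (K : ℚ)) : ℚ) = (q : ℚ) := by
      have hKq : (K : ℚ) ≠ 0 := Nat.cast_ne_zero.mpr hK0.ne'
      rw [← mul_div_assoc, div_eq_iff hKq, he, hq]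
      push_cast
      ring
    rw [Automorphism.pow_apply_of_mem_sector (hw i), hee, Rat.cast_natCast, mul_comm,
      Complex.exp_nat_mul_two_pi_mul_I, one_smul]
    rfl
  have he0 : 0 < e := Nat.pos_of_ne_zero fun h => by rw [h, mul_zero] at he; omega
  have hle : K ≤ e := Nat.le_of_dvd he0 (orderOf_dvd_of_pow_eq_one hpow)
  have hd1 : d.natAbs = 1 := by
    have : d.natAbs * e ≤ 1 * e := by rw [← he, one_mul]; exact hle
    have h1 := Nat.le_of_mul_le_mul_right this he0
    have h2 : d.natAbs ≠ 0 := fun h => by rw [h, zero_mul] at he; omega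
    omega
  have hr : r ∈ H := by
    rw [hd, Int.mem_zmultiples_iff, ← Int.natAbs_dvd_natAbs, hd1]
    exact one_dvd _
  have := (hr 0).mpr hp0
  rwa [zero_add] at this

end TwistedModule

end Classes

/-! ### The homomorphism M → Ind M^r -/

section Component

variable {V : Type u} [AddCommGroup V] [Module ℂ V] {𝒱 : VertexOperatorAlgebra V}
  {g : 𝒱.Automorphism} {M : Type u} [AddCommGroup M] [Module ℂ M]

namespace TwistedModule

/-- The projection of `M` onto `M^r` that vanishes on all other weights. -/
def componentProj (Y : TwistedModule g M) (μ : ℂ) (r : ℤ) : M →ₗ[ℂ] Y.component μ r :=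
  (Y.weightProj (μ - (r : ℂ) / (orderOf g.toEquiv : ℂ))).codRestrict _ (Y.weightProj_mem _)

theorem componentProj_coe (Y : TwistedModule g M) (μ : ℂ) (r : ℤ) (x : Y.component μ r) :
    Y.componentProj μ r x = x :=
  Subtype.ext (Y.weightProj_of_mem x.2)

theorem componentProj_eq_zero (Y : TwistedModule g M) (μ : ℂ) (r : ℤ) {x : M}
    (hx : x ∈ Y.weightCoclass (μ - (r : ℂ) / (orderOf g.toEquiv : ℂ))) :
    Y.componentProj μ r x = 0 :=
  Subtype.ext (Y.weightProj_eq_zero_iff.mpr hx)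

/-- The projection is V⁰-linear, because vectors of V⁰ have only integral modes; this is what makes
`toInd` land in the coinduced module. -/
theorem componentProj_action (Y : TwistedModule g M) (μ : ℂ) (r : ℤ) (b : g.onFixed.A) (x : M) :
    Y.componentProj μ r (Y.action (g.psi b) x)
      = (Y.componentModule μ r).action b (Y.componentProj μ r x) := by
  rw [← Y.action_restrict]
  refine Y.restrict.map_action (Y.componentModule μ r) _ (fun n v x => Subtype.ext ?_) b x
  change Y.weightProj _ (Y.mode n (v : V) x) = Y.mode n (v : V) (Y.weightProj _ x)
  by_cases hn : ∃ k : ℤ, n = (0 : ℚ) + k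
  · obtain ⟨k, rfl⟩ := hn
    rw [zero_add]
    exact Y.weightProj_mode_int _ k v x
  · rw [Y.mode_support 0 n v (g.fixed_mem_sector v) hn, LinearMap.zero_apply, map_zero,
      LinearMap.zero_apply]

theorem action_mul (Y : TwistedModule g M) (a b : g.A) (x : M) :
    Y.action (a * b) x = Y.action a (Y.action b x) := by
  rw [map_mul]
  rfl

/-- The `A(g)`-homomorphism `M → Ind M^r` adjoint to the projection `M → M^r`. -/
def toInd (Y : TwistedModule g M) (μ : ℂ) (r : ℤ) :
    Y.Carrier →ₗ[g.A] g.Ind (Y.componentModule μ r) where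
  toFun m := ⟨⟨Y.componentProj μ r ∘ₗ LinearMap.applyₗ (R := ℂ) (show M from m) ∘ₗ
      Y.action.toLinearMap, fun a x => by
        change Y.componentProj μ r (Y.action (g.psi a * x) m) = _
        rw [map_mul]
        exact Y.componentProj_action μ r a _⟩,
    -- The map x ↦ π(xm) is killed by Ann(m) itself.
    ⟨Y.annihilator m, ⟨M, _, _, Y, m, rfl⟩, fun a ha => Subtype.ext (LinearMap.ext fun x => by
      change Y.componentProj μ r (Y.action (x * a) m) = 0
      have h : Y.action a m = 0 := ha
      exact (congrArg (Y.componentProj μ r) ((Y.action_mul x a m).trans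
        ((congrArg (Y.action x) h).trans (map_zero _)))).trans (map_zero _))⟩⟩
  map_add' m m' := Subtype.ext (Subtype.ext (LinearMap.ext fun x => by
    change Y.componentProj μ r (Y.action x ((show M from m) + (show M from m'))) = _
    rw [map_add, map_add]
    rfl))
  map_smul' a m := Subtype.ext (Subtype.ext (LinearMap.ext fun x => by
    change Y.componentProj μ r (Y.action x (Y.action a m)) =
      Y.componentProj μ r (Y.action (x * a) m)
    exact congrArg (Y.componentProj μ r) (Y.action_mul x a m).symm))

theorem toInd_apply (Y : TwistedModule g M) (μ : ℂ) (r : ℤ) (m : M) (x : g.A) :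
    (Y.toInd μ r m).1.1 x = Y.componentProj μ r (Y.action x m) := rfl

theorem action_algebraMap (Y : TwistedModule g M) (c : ℂ) (x : M) :
    Y.action (algebraMap ℂ g.A c) x = c • x := by
  rw [AlgHom.commutes]
  rfl

/-- Modes and scalars both act through A(g), so an A(g)-submodule is a subspace stable under all
modes. -/
theorem IsSimple.isSimpleModule {Y : TwistedModule g M} (hM : Y.IsSimple)
    (hg : IsOfFinOrder g.toEquiv) : IsSimpleModule g.A Y.Carrier := by
  have : Nontrivial Y.Carrier := hM.1
  rw [isSimpleModule_iff]
  refine ⟨fun P => ?_⟩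
  let N : Submodule ℂ M :=
    { carrier := {x : M | (show Y.Carrier from x) ∈ P}
      add_mem' := fun ha hb => P.add_mem ha hb
      zero_mem' := P.zero_mem
      smul_mem' := fun c x hx => by
        have h := P.smul_mem (algebraMap ℂ g.A c) hx
        change Y.action (algebraMap ℂ g.A c) x ∈ P at h
        rwa [Y.action_algebraMap] at h }
  have hN : ∀ (n : ℚ) (v : V), ∀ x ∈ N, Y.mode n v x ∈ N := fun n v x hx => by
    obtain ⟨a, ha⟩ := g.exists_action_eq_mode hg n v
    rw [← ha M Y]
    exact P.smul_mem a hx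
  rcases hM.2 N hN with h | h
  · exact Or.inl (eq_bot_iff.mpr fun x hx => by
      have : (show M from x) ∈ N := hx
      rw [h] at this
      exact this)
  · exact Or.inr (eq_top_iff.mpr fun x _ => by
      have : (show M from x) ∈ N := h ▸ Submodule.mem_top
      exact this)

/-- By Schur it suffices that the map is nonzero: evaluation at 1 recovers any nonzero vector of
M^r. -/
theorem toInd_injective (hV : 𝒱.IsSimple) (hg : IsOfFinOrder g.toEquiv) {Y : TwistedModule g M}
    (hM : Y.IsSimple) {μ : ℂ} (hμ : Y.weightSpace μ ≠ ⊥) (r : ℤ) :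
    Function.Injective (Y.toInd μ r) := by
  have := hM.isSimpleModule hg
  refine (LinearMap.injective_or_eq_zero (Y.toInd μ r)).resolve_right fun h => ?_
  obtain ⟨x, hx, hx0⟩ := (Submodule.ne_bot_iff _).mp (Y.weightClass_ne_bot hV hg hμ r)
  have h1 : (0 : Y.component μ r) = Y.componentProj μ r (Y.action 1 x) := by
    rw [← Y.toInd_apply μ r x 1, h]
    rfl
  rw [map_one, Module.End.one_apply, Y.componentProj_coe μ r ⟨x, hx⟩] at h1
  exact hx0 (congrArg Subtype.val h1).symm

/-! ### V⁰-homomorphisms from a twisted module into M^r -/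

section Transfer

variable {W : Type u} [AddCommGroup W] [Module ℂ W] (Z : TwistedModule g W)
  (Y : TwistedModule g M) {μ : ℂ} {r : ℤ} (h : W →ₗ[ℂ] Y.component μ r)

/-- The conformal vector is fixed by g, so h commutes with L(0) and preserves weights. -/
theorem eq_zero_of_mem_weightCoclass
    (hh : ∀ (n : ℚ) (v : g.fixedSpace) (x : W),
      h (Z.mode n (v : V) x) = (Y.componentModule μ r).mode n v (h x)) {x : W}
    (hx : x ∈ Z.weightCoclass (μ - (r : ℂ) / (orderOf g.toEquiv : ℂ))) : h x = 0 := by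
  unfold weightCoclass at hx
  rw [iSup_subtype'] at hx
  induction hx using Submodule.iSup_induction' with
  | zero => rw [map_zero]
  | add y z _ _ hy hz => rw [map_add, hy, hz, add_zero]
  | mem ν y hy =>
    have h1 := congrArg Subtype.val (hh 1 ⟨𝒱.conf, g.map_conf⟩ y)
    change ((h (Z.mode 1 𝒱.conf y) : Y.component μ r) : M) = Y.mode 1 𝒱.conf (h y : M) at h1
    rw [Module.End.mem_eigenspace_iff.mp hy, map_smul] at h1
    have h2 : (h y : M) ∈ Y.weightSpace ν := Module.End.mem_eigenspace_iff.mpr h1.symm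
    have h3 : (h y : M) ∈ Y.weightCoclass (μ - (r : ℂ) / (orderOf g.toEquiv : ℂ)) :=
      le_biSup Y.weightSpace ν.2 h2
    exact Subtype.ext (Submodule.disjoint_def.mp (Y.isCompl_weightClass _).disjoint _ (h y).2 h3)

/-- A `V⁰`-homomorphism into `M^r` is compatible with `A(g)` on vectors whose weights are those
of `M^r` modulo `ℤ`, up to the projection `M → M^r`. -/
theorem map_action_eq_componentProj (hg : IsOfFinOrder g.toEquiv)
    (hh : ∀ (n : ℚ) (v : g.fixedSpace) (x : W),
      h (Z.mode n (v : V) x) = (Y.componentModule μ r).mode n v (h x)) {w : W}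
    (hw : w ∈ Z.weightClass (μ - (r : ℂ) / (orderOf g.toEquiv : ℂ))) (a : g.A) :
    h (Z.action a w) = Y.componentProj μ r (Y.action a (h w : M)) := by
  -- The desired identity says that the pair (aw, a h(w)) lies in a linear subspace of W × M. That
  -- subspace need not be stable under modes, but by the spanning result it is enough to test single
  -- modes applied to (w, h(w)).
  have key := (Z.prod Y).action_mem_of_mode_mem hg (w := (w, (h w : M)))
    (P := LinearMap.eqLocus (h ∘ₗ LinearMap.fst ℂ W M)
      (Y.componentProj μ r ∘ₗ LinearMap.snd ℂ W M)) (fun n v => ?_) a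
  · rw [action_prod] at key
    exact key
  · change h (Z.mode n v w) = Y.componentProj μ r (Y.mode n v (h w : M))
    by_cases hn : ∀ k : ℤ, n ≠ k
    · rw [Z.eq_zero_of_mem_weightCoclass Y h hh (Z.mode_mem_weightCoclass hn v hw),
        Y.componentProj_eq_zero μ r (Y.mode_mem_weightCoclass hn v (h w).2)]
    · push Not at hn
      obtain ⟨k, rfl⟩ := hn
      -- An integral mode may be replaced by the same mode of a g-fixed vector, chosen independently
      -- of the module, and h commutes with it.
      obtain ⟨v₀, hv₀, hv⟩ := g.exists_fixed hg v
      rw [hv, hv, hh k ⟨v₀, hv₀⟩ w]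
      exact (Y.componentProj_coe μ r ((Y.componentModule μ r).mode k ⟨v₀, hv₀⟩ (h w))).symm

end Transfer

theorem isOfFinOrder_onFixed : IsOfFinOrder g.onFixed.toEquiv :=
  IsOfFinOrder.one

/-- Every nonzero element of `Ind M^r` has a nonzero multiple in the image of `M`. -/
theorem exists_smul_eq_toInd (hg : IsOfFinOrder g.toEquiv) (Y : TwistedModule g M) (μ : ℂ) (r : ℤ)
    (t : g.Ind (Y.componentModule μ r)) (ht : t ≠ 0) :
    ∃ (a : g.A) (m : Y.Carrier), a • t = Y.toInd μ r m ∧ a • t ≠ 0 := by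
  obtain ⟨_, ⟨W, _, _, Z, w, rfl⟩, hJ⟩ := t.2
  let f : g.A →ₗ[ℂ] Y.component μ r := t.1.1
  have hf : ∀ (b : g.onFixed.A) (x : g.A), f (g.psi b * x) = (Y.componentModule μ r).action b (f x) :=
    t.1.2
  let φ : g.A →ₗ[ℂ] W := LinearMap.applyₗ (R := ℂ) w ∘ₗ Z.action.toLinearMap
  have hφ : ∀ a, φ a = Z.action a w := fun _ => rfl
  -- If aw = 0 then at = 0, and evaluating at 1 gives f(a) = 0. Hence f factors through A(g)w, the
  -- range of φ.
  have hker : LinearMap.ker φ ≤ LinearMap.ker f := fun a ha => by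
    have h1 := congrArg (fun s : g.Coind _ => s.1 (1 : g.A)) (hJ a ha)
    change f (1 * a) = 0 at h1
    rwa [one_mul] at h1
  let h : LinearMap.range φ →ₗ[ℂ] Y.component μ r :=
    (LinearMap.ker φ).liftQ f hker ∘ₗ φ.quotKerEquivRange.symm.toLinearMap
  have hφh : ∀ (x : LinearMap.range φ) (a : g.A), (x : W) = φ a → h x = f a := by
    rintro ⟨_, hx⟩ a rfl
    change (LinearMap.ker φ).liftQ f hker (φ.quotKerEquivRange.symm ⟨φ a, hx⟩) = f a
    rw [LinearMap.quotKerEquivRange_symm_apply_image, Submodule.mkQ_apply, Submodule.liftQ_apply]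
  let Z₁ : TwistedModule g (LinearMap.range φ) := Z.sub (LinearMap.range φ) fun n v x hx => by
    obtain ⟨a, rfl⟩ := hx
    obtain ⟨b, hb⟩ := g.exists_action_eq_mode hg n v
    exact ⟨b * a, by rw [hφ, hφ, map_mul, ← hb W Z]; rfl⟩
  have hZ₁ : ∀ (a : g.A) (x : LinearMap.range φ), ((Z₁.action a x : LinearMap.range φ) : W)
      = Z.action a (x : W) :=
    fun a x => Z₁.map_action Z (LinearMap.range φ).subtype (fun _ _ _ => rfl) a x
  have hh : ∀ (n : ℚ) (v : g.fixedSpace) (x : LinearMap.range φ),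
      h (Z₁.mode n (v : V) x) = (Y.componentModule μ r).mode n v (h x) := by
    rintro n v ⟨_, a, rfl⟩
    -- Modes of V⁰ come from A(V⁰), so the A(V⁰)-linearity of f makes h a V⁰-homomorphism.
    obtain ⟨b, hb⟩ := g.onFixed.exists_action_eq_mode isOfFinOrder_onFixed n v
    rw [hφh ⟨φ a, a, rfl⟩ a rfl, ← hb _ (Y.componentModule μ r), ← hf]
    refine hφh _ _ ?_
    change Z.restrict.mode n v (φ a) = _
    rw [← hb W Z.restrict, Z.action_restrict, hφ, hφ, map_mul]
    rfl
  obtain ⟨a₀, ha₀⟩ : ∃ a₀, f a₀ ≠ 0 := by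
    by_contra! hcon
    exact ht (Subtype.ext (Subtype.ext (LinearMap.ext hcon)))
  let c := μ - (r : ℂ) / (orderOf g.toEquiv : ℂ)
  -- Discarding the weights outside c + ℤ does not change the value of h, and it makes the transfer
  -- identity applicable.
  let w₀ := Z₁.weightProj c ⟨φ a₀, a₀, rfl⟩
  have hw₀ : h w₀ = f a₀ := by
    have h1 := Z₁.eq_zero_of_mem_weightCoclass Y h hh
      (Submodule.sub_projection_mem (Z₁.isCompl_weightClass c) ⟨φ a₀, a₀, rfl⟩)
    rw [map_sub, sub_eq_zero, hφh ⟨φ a₀, a₀, rfl⟩ a₀ rfl] at h1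
    exact h1.symm
  -- Since w₀ = a₁w, the function a₁t is x ↦ f(xa₁) = h(xw₀) = π(x h(w₀)), with value f(a₀) ≠ 0 at
  -- 1.
  obtain ⟨a₁, ha₁⟩ := w₀.2
  refine ⟨a₁, (h w₀ : M), Subtype.ext (Subtype.ext (LinearMap.ext fun x => ?_)), fun h0 => ?_⟩
  · change f (x * a₁) = Y.componentProj μ r (Y.action x (h w₀ : M))
    rw [← Z₁.map_action_eq_componentProj Y h hg hh (Z₁.weightProj_mem c _) x]
    refine (hφh _ _ ?_).symm
    rw [hZ₁, ← ha₁, hφ, hφ, map_mul]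
    rfl
  · have h1 := congrArg (fun s : g.Ind (Y.componentModule μ r) => s.1.1 (1 : g.A)) h0
    change f (1 * a₁) = 0 at h1
    rw [one_mul, ← hφh w₀ a₁ ha₁.symm, hw₀] at h1
    exact ha₀ h1

end TwistedModule

end Component

end VertexOperatorAlgebra

end

/-! ### The unique simple submodule and the socle -/

theorem mainTheorem6 {V : Type u} [AddCommGroup V] [Module ℂ V] (𝒱 : VertexOperatorAlgebra V)
    (hV : 𝒱.IsSimple) (g : 𝒱.Automorphism) (hg : IsOfFinOrder g.toEquiv)
    {M : Type u} [AddCommGroup M] [Module ℂ M] (Y : VertexOperatorAlgebra.TwistedModule g M)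
    (hM : Y.IsSimple) (μ : ℂ) (hμ : Y.weightSpace μ ≠ ⊥) (r : ℤ) :
    Nontrivial (g.Ind (Y.componentModule μ r)) ∧
    (∃ S : Submodule g.A (g.Ind (Y.componentModule μ r)),
      (IsSimpleModule g.A S ∧ Nonempty (S ≃ₗ[g.A] Y.Carrier)) ∧
      ∀ T : Submodule g.A (g.Ind (Y.componentModule μ r)), IsSimpleModule g.A T → T = S) ∧
    (∃ D, VertexOperatorAlgebra.IsSimpleDecomposition
      (VertexOperatorAlgebra.socle g.A (g.Ind (Y.componentModule μ r))) D) ∧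
    ∀ D : Set (Submodule g.A (g.Ind (Y.componentModule μ r))),
      VertexOperatorAlgebra.IsSimpleDecomposition
        (VertexOperatorAlgebra.socle g.A (g.Ind (Y.componentModule μ r))) D →
      ∃! S : Submodule g.A (g.Ind (Y.componentModule μ r)),
        S ∈ D ∧ Nonempty (S ≃ₗ[g.A] Y.Carrier) := by
  have hsimple := hM.isSimpleModule hg
  let e := LinearEquiv.ofInjective (Y.toInd μ r)
    (VertexOperatorAlgebra.TwistedModule.toInd_injective hV hg hM hμ r)
  set S := LinearMap.range (Y.toInd μ r) with hS
  have hSs : IsSimpleModule g.A S := IsSimpleModule.congr e.symm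
  have hSa : IsAtom S := isSimpleModule_iff_isAtom.mp hSs
  have huniq : ∀ T : Submodule g.A (g.Ind (Y.componentModule μ r)), IsSimpleModule g.A T →
      T = S := fun T hT => by
    have hTa : IsAtom T := isSimpleModule_iff_isAtom.mp hT
    obtain ⟨t, htT, ht0⟩ := (Submodule.ne_bot_iff _).mp hTa.1
    -- Essentiality puts a nonzero vector in the intersection of T and S, whereas distinct atoms are
    -- disjoint.
    obtain ⟨a, m, ham, ha0⟩ := Y.exists_smul_eq_toInd hg μ r t ht0
    by_contra hne
    have hd := Submodule.disjoint_def.mp (hTa.disjoint_of_ne hSa hne) _ (T.smul_mem a htT)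
    exact ha0 (hd (ham ▸ ⟨m, rfl⟩))
  have hset : {T : Submodule g.A (g.Ind (Y.componentModule μ r)) | IsSimpleModule g.A T} = {S} :=
    Set.ext fun T => ⟨huniq T, fun h => by rw [h]; exact hSs⟩
  have hsoc : VertexOperatorAlgebra.socle g.A (g.Ind (Y.componentModule μ r)) = S := by
    rw [VertexOperatorAlgebra.socle, hset, sSup_singleton]
  obtain ⟨t, -, ht0⟩ := (Submodule.ne_bot_iff _).mp hSa.1
  refine ⟨nontrivial_of_ne t 0 ht0, ⟨S, ⟨hSs, ⟨e.symm⟩⟩, huniq⟩,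
    ⟨{S}, fun T hT => by rw [hT]; exact hSs, sSupIndep_singleton S, by
      rw [hsoc, sSup_singleton]⟩, fun D hD => ⟨S, ⟨?_, ⟨e.symm⟩⟩, fun T hT => huniq T (hD.1 T hT.1)⟩⟩
  -- Every member of D equals S, so D could avoid S only by being empty, and then the socle would be
  -- zero.
  by_contra hSD
  have hempty : D = ∅ := Set.eq_empty_of_forall_notMem fun T hT => hSD (huniq T (hD.1 T hT) ▸ hT)
  have hbot := hD.2.2
  rw [hempty, sSup_empty, hsoc] at hbot
  exact hSa.1 hbot.symm
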